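/- All graphs are finite and simple, and classes of graphs are closed under isomorphism. A set $S\subseteq V(G)$ is a balanced separator of $G$ if every connected component of $G-S$ has at most $\frac23|V(G)|$ vertices. The notation $\tilde{\mathcal O}(g)$ stands for $\mathcal O(g\cdot\log^{k} g)$ for some constant $k$. To solve Max Induced $\mathcal C$-Subgraph on $\mathcal D$ means to find, given a graph $G\in\mathcal D$, a largest set $A\subseteq V(G)$ such that $G[A]\in\mathcal C$ (or to report that no set $A$ with $G[A]\in\mathcal C$ exists). Theorem. Let $\mathcal C$ and $\mathcal D$ be classes of graphs such that (P1) every $n$-vertex graph from $\mathcal C$ has $\mathcal O(n)$ edges; (P2) $\mathcal D$ is closed under taking induced subgraphs; (P3) Max Induced $\mathcal C$-Subgraph on $\mathcal D$ can be solved in $2^{\tilde{\mathcal O}(w)}\cdot n^{\mathcal O(1)}$ time, where $n$ is the number of vertices and $w$ is the treewidth of the input graph. Then: (a) if every graph in $\mathcal D$ with maximum degree $\Delta$ has a balanced separator of size $\mathcal O(\Delta+1)$, then Max Induced $\mathcal C$-Subgraph on $\mathcal D$ can be solved in $2^{\tilde{\mathcal O}(n^{2/3})}$ time on $n$-vertex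 graphs; (b) if every graph in $\mathcal D$ with $n$ vertices and maximum degree $\Delta$ has a balanced separator of size $\mathcal O(\sqrt{n\Delta}+1)$, then Max Induced $\mathcal C$-Subgraph on $\mathcal D$ can be solved in $2^{\tilde{\mathcal O}(n^{3/4})}$ time on $n$-vertex graphs. -/

import Mathlib

/-- A class of graphs: a property of graphs that is invariant under isomorphism.
Only its finite members matter below. -/
structure GraphClass where
  Mem : ∀ {V : Type}, SimpleGraph V → Prop
  iso : ∀ {V W : Type} {G : SimpleGraph V} {H : SimpleGraph W},
    Nonempty (G ≃g H) → Mem G → Mem H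

/-- Every `n`-vertex graph of the class has `O(n)` edges. -/
def GraphClass.LinearlySparse (C : GraphClass) : Prop :=
  ∃ c : ℝ, ∀ (V : Type) [Fintype V] (G : SimpleGraph V), C.Mem G →
    (G.edgeSet.ncard : ℝ) ≤ c * Fintype.card V

/-- The class is closed under taking induced subgraphs. -/
def GraphClass.Hereditary (D : GraphClass) : Prop :=
  ∀ (V : Type) [Fintype V] (G : SimpleGraph V), D.Mem G →
    ∀ A : Set V, D.Mem (G.induce A)

/-- `S` is a balanced separator of `G`: every connected component of `G - S` has at most
`2/3 * |V(G)|` vertices. -/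
def IsBalancedSeparator {V : Type} [Fintype V] (G : SimpleGraph V) (S : Finset V) : Prop :=
  ∀ K : (G.induce ((S : Set V)ᶜ)).ConnectedComponent,
    3 * K.supp.ncard ≤ 2 * Fintype.card V

/-- Every graph of the class with maximum degree `Δ` has a balanced separator of size `O(Δ)`.
The summand `1` only matters for edgeless graphs: a one-vertex graph has `Δ = 0`, but its only
balanced separator has one vertex. -/
def GraphClass.DegreeSeparators (D : GraphClass) : Prop :=
  ∃ c : ℝ, ∀ (V : Type) [Fintype V] (G : SimpleGraph V) [DecidableRel G.Adj], D.Mem G →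
    ∃ S : Finset V, IsBalancedSeparator G S ∧ (S.card : ℝ) ≤ c * ((G.maxDegree : ℝ) + 1)

/-- Every graph of the class with `n` vertices and maximum degree `Δ` has a balanced separator
of size `O(√(nΔ))` (with the same summand `1` for edgeless graphs). -/
def GraphClass.SqrtDegreeSeparators (D : GraphClass) : Prop :=
  ∃ c : ℝ, ∀ (V : Type) [Fintype V] (G : SimpleGraph V) [DecidableRel G.Adj], D.Mem G →
    ∃ S : Finset V, IsBalancedSeparator G S ∧
      (S.card : ℝ) ≤ c * (Real.sqrt ((Fintype.card V : ℝ) * (G.maxDegree : ℝ)) + 1)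

/-- A tree decomposition of `G`: a finite tree with a bag for every node, such that the nodes
whose bags contain a given vertex induce a (nonempty) connected subtree and every edge lies in
some bag. -/
structure TreeDecomposition {V : Type} (G : SimpleGraph V) where
  Node : Type
  finite_node : Finite Node
  tree : SimpleGraph Node
  isTree : tree.IsTree
  bag : Node → Finset V
  connected : ∀ u : V, (tree.induce {x | u ∈ bag x}).Connected
  edge : ∀ u v : V, G.Adj u v → ∃ x, u ∈ bag x ∧ v ∈ bag x

/-- The treewidth of a graph: the least `w` such that some tree decomposition has all bags of
size at most `w + 1`. -/
noncomputable def treewidth {V : Type} (G : SimpleGraph V) : ℕ :=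
  sInf {w : ℕ | ∃ T : TreeDecomposition G, ∀ x : T.Node, (T.bag x).card ≤ w + 1}

/-- `f = Õ(g)`: `f` is at most `g`, up to a constant factor and a factor polylogarithmic in `g`.
The summands `1` and `2` only matter where `g` is small. -/
def SoftO (f g : ℕ → ℝ) : Prop :=
  ∃ (c : ℝ) (k : ℕ), ∀ m : ℕ, f m ≤ c * (g m + 1) * (Real.logb 2 (g m + 2)) ^ k

namespace WhileLang

/-!
The machine model is the classical WHILE language over binary trees, with the standard unit-cost
measure: every elementary operation (reading a variable, the constant `nil`, `cons`, `hd`, `tl`,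
an assignment, a test) costs one step. Trees are immutable and are shared when they are copied
(as in Lisp), which makes the unit cost fair: this model and the multitape Turing machine
simulate each other with polynomial overhead, so that none of the time bounds stated below
depends on the choice between them. A program is one finite object, which serves all inputs.
-/

/-- The data values: binary trees. -/
inductive Val where
  | nil : Val
  | cons : Val → Val → Val

/-- The left subtree. -/
def Val.hd : Val → Val
  | .nil => .nil
  | .cons a _ => a

/-- The right subtree. -/
def Val.tl : Val → Val
  | .nil => .nil
  | .cons _ b => b

/-- Expressions; variables are numbered. -/
inductive Expr where
  | var : ℕ → Expr
  | nil : Expr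
  | cons : Expr → Expr → Expr
  | hd : Expr → Expr
  | tl : Expr → Expr

/-- A store assigns a value to every variable. -/
abbrev Store : Type := ℕ → Val

/-- The value of an expression. -/
def Expr.eval (s : Store) : Expr → Val
  | .var i => s i
  | .nil => .nil
  | .cons a b => .cons (a.eval s) (b.eval s)
  | .hd a => (a.eval s).hd
  | .tl a => (a.eval s).tl

/-- The time it takes to evaluate an expression: the number of operations in it. -/
def Expr.cost : Expr → ℕ
  | .var _ => 1
  | .nil => 1
  | .cons a b => a.cost + b.cost + 1
  | .hd a => a.cost + 1
  | .tl a => a.cost + 1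

/-- Programs. -/
inductive Prog where
  | skip : Prog
  | assign : ℕ → Expr → Prog
  | seq : Prog → Prog → Prog
  | ite : Expr → Prog → Prog → Prog
  | loop : Expr → Prog → Prog

/-- `Exec p s t s'`: started in the store `s`, the program `p` halts after exactly `t` steps in
the store `s'`. The value `nil` counts as false, every other value as true. -/
inductive Exec : Prog → Store → ℕ → Store → Prop where
  | skip (s : Store) : Exec .skip s 1 s
  | assign (i : ℕ) (e : Expr) (s : Store) :
      Exec (.assign i e) s (e.cost + 1) (Function.update s i (e.eval s))
  | seq {p q : Prog} {s s' s'' : Store} {t u : ℕ} :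
      Exec p s t s' → Exec q s' u s'' → Exec (.seq p q) s (t + u) s''
  | ite_true {e : Expr} {p q : Prog} {s s' : Store} {t : ℕ} :
      e.eval s ≠ .nil → Exec p s t s' → Exec (.ite e p q) s (e.cost + 1 + t) s'
  | ite_false {e : Expr} {p q : Prog} {s s' : Store} {t : ℕ} :
      e.eval s = .nil → Exec q s t s' → Exec (.ite e p q) s (e.cost + 1 + t) s'
  | loop_true {e : Expr} {p : Prog} {s s' s'' : Store} {t u : ℕ} :
      e.eval s ≠ .nil → Exec p s t s' → Exec (.loop e p) s' u s'' →
      Exec (.loop e p) s (e.cost + 1 + t + u) s''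
  | loop_false {e : Expr} {p : Prog} {s : Store} :
      e.eval s = .nil → Exec (.loop e p) s (e.cost + 1) s

/-- The initial store: the input is in variable `0`, and every other variable is `nil`. -/
def initStore (input : Val) : Store :=
  fun i => if i = 0 then input else .nil

/-- The program `p` halts on `input` after exactly `t` steps with `output` in variable `0`. -/
def Prog.Outputs (p : Prog) (input : Val) (t : ℕ) (output : Val) : Prop :=
  ∃ s : Store, Exec p (initStore input) t s ∧ s 0 = output

/-- Truth values as trees. -/
def encodeBool : Bool → Val
  | false => .nil
  | true => .cons .nil .nil

/-- Lists as trees. -/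
def encodeList {α : Type} (f : α → Val) : List α → Val
  | [] => .nil
  | a :: l => .cons (f a) (encodeList f l)

open Classical in
/-- A graph on the vertices `0, …, n - 1` is given by its adjacency matrix, as the list of its
rows. -/
noncomputable def encodeGraph {n : ℕ} (G : SimpleGraph (Fin n)) : Val :=
  encodeList (encodeList encodeBool)
    (List.ofFn fun i : Fin n => List.ofFn fun j : Fin n => decide (G.Adj i j))

/-- A set of vertices is given by its characteristic vector. -/
def encodeSet {n : ℕ} (A : Finset (Fin n)) : Val :=
  encodeList encodeBool (List.ofFn fun i : Fin n => decide (i ∈ A))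

/-- The answer of an algorithm: a set of vertices, or the report that there is no solution. -/
def encodeAnswer {n : ℕ} : Option (Finset (Fin n)) → Val
  | none => .nil
  | some A => .cons .nil (encodeSet A)

end WhileLang

/-- A correct answer to Max Induced `C`-Subgraph on `G`: a largest set `A` of vertices with
`G[A] ∈ C`, or `none` if no set `A` has `G[A] ∈ C` (which can only happen if the graph without
vertices is not in `C`). -/
def IsMaxInducedAnswer (C : GraphClass) {n : ℕ} (G : SimpleGraph (Fin n)) :
    Option (Finset (Fin n)) → Prop
  | some A => C.Mem (G.induce (A : Set (Fin n))) ∧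
      ∀ B : Finset (Fin n), C.Mem (G.induce (B : Set (Fin n))) → B.card ≤ A.card
  | none => ∀ B : Finset (Fin n), ¬ C.Mem (G.induce (B : Set (Fin n)))

/-- Max Induced `C`-Subgraph on `D` can be solved in time `T`: one program gives, on every graph
`G` in `D`, a correct answer within `T G` steps. Nothing is required on graphs outside `D`. -/
def MaxInducedSolvableInTime (C D : GraphClass)
    (T : ∀ {n : ℕ}, SimpleGraph (Fin n) → ℝ) : Prop :=
  ∃ p : WhileLang.Prog, ∀ (n : ℕ) (G : SimpleGraph (Fin n)), D.Mem G →
    ∃ (ans : Option (Finset (Fin n))) (t : ℕ), IsMaxInducedAnswer C G ans ∧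
      p.Outputs (WhileLang.encodeGraph G) t (WhileLang.encodeAnswer ans) ∧ (t : ℝ) ≤ T G

/-- Solvable in `2^{Õ(w)} · n^{O(1)}` time, where `w` is the treewidth and `n` the number of
vertices of the input graph. -/
def SolvableInTreewidthTime (C D : GraphClass) : Prop :=
  ∃ (f : ℕ → ℝ) (d : ℕ), SoftO f (fun w => (w : ℝ)) ∧
    MaxInducedSolvableInTime C D
      (fun {n} G => (2 : ℝ) ^ f (treewidth G) * ((n : ℝ) + 1) ^ d)

/-- Solvable in `2^{Õ(n^a)}` time, where `n` is the number of vertices of the input graph. -/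
def SolvableInSubexpTime (C D : GraphClass) (a : ℝ) : Prop :=
  ∃ f : ℕ → ℝ, SoftO f (fun n => (n : ℝ) ^ a) ∧
    MaxInducedSolvableInTime C D (fun {n} _ => (2 : ℝ) ^ f n)

/-!
The theorem holds because a sparse induced subgraph can be confined, by a small amount of guessed
information, to an induced subgraph of small treewidth on which the given solver is fast.

Let `e = 3` in the first part and `e = 4` in the second one (`e = q + 2` below), and let `r` be
`n ^ (1 / e)`, rounded up. Let `A` be a largest solution. As `G[A]` has `O(n)` edges, the set `X`
of its vertices of degree more than `r` has `O(n / r)` elements. Choose a maximal set `P` of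
*pivots* in `A \ X` with at least `r ^ 2 |P|` neighbours outside of `A`; so `|P| ≤ n / r ^ 2`. The
set `Z` of *protected* vertices consists of `X`, `P` and the neighbours of pivots in `A`, and has
`O(r ^ (e - 1))` elements. Delete all unprotected neighbours of pivots, and then all unprotected
vertices that still have more than `r ^ 2 + r` surviving neighbours. No vertex of `A` is deleted,
since an unprotected vertex of `A` with many surviving neighbours could be added to the pivots
(`exists_pivots`). The pair of `P` and `Z` is the *certificate*; what is kept depends on it alone.

Conversely, whatever the certificate is, the kept graph has maximum degree `O(r ^ 2)` apart from the
protected vertices. In both parts of the theorem this gives balanced separators of size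
`O(r ^ (e - 1))` in all its induced subgraphs without protected vertices
(`GraphClass.PowerSeparators`), and by recursive separation its treewidth is
`O(r ^ (e - 1) log n)` (`exists_labelling`, `treewidth_le_of_powerSeparators`). The algorithm
enumerates all certificates, of which there are `n ^ O(r ^ (e - 1))`, solves the problem on each of
the kept graphs, and returns the largest answer (`mainVal_spec`). No clock is needed, because the
solver is fast on every kept graph.

The algorithm is built as a function on trees from combinators that are known to be computable by
WHILE programs. `RunsIn` records an explicit time bound and a domain, and serves for the solver and
for the two loops of exponential length; `PolyTime` serves for everything else. The time bound is
`runsIn_mainVal`.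
-/

namespace WhileLang

/-! ### Programs: variables in use, and independence of the others -/

/-- All variables of the expression are smaller than this number. -/
def Expr.bound : Expr → ℕ
  | .var i => i + 1
  | .nil => 0
  | .cons a b => max a.bound b.bound
  | .hd a => a.bound
  | .tl a => a.bound

/-- All variables of the program are smaller than this number. -/
def Prog.bound : Prog → ℕ
  | .skip => 0
  | .assign i e => max (i + 1) e.bound
  | .seq p q => max p.bound q.bound
  | .ite e p q => max e.bound (max p.bound q.bound)
  | .loop e p => max e.bound p.bound

theorem Expr.eval_congr {N : ℕ} {s r : Store} (h : ∀ i < N, s i = r i) :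
    ∀ e : Expr, e.bound ≤ N → e.eval s = e.eval r
  | .var i, he => h i he
  | .nil, _ => rfl
  | .cons a b, he => by
      simp only [Expr.bound, max_le_iff] at he
      simp only [Expr.eval, eval_congr h a he.1, eval_congr h b he.2]
  | .hd a, he => by simp only [Expr.eval, eval_congr h a he]
  | .tl a, he => by simp only [Expr.eval, eval_congr h a he]

theorem Exec.frame {p : Prog} {s s' : Store} {t : ℕ} (h : Exec p s t s') :
    ∀ i, p.bound ≤ i → s' i = s i := by
  induction h with
  | skip s => intro i _; rfl
  | assign j e s =>
      intro i hi
      simp only [Prog.bound, max_le_iff] at hi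
      exact Function.update_of_ne (by omega) _ _
  | seq _ _ h1 h2 =>
      intro i hi
      simp only [Prog.bound, max_le_iff] at hi
      rw [h2 i hi.2, h1 i hi.1]
  | ite_true _ _ h1 =>
      intro i hi
      simp only [Prog.bound, max_le_iff] at hi
      exact h1 i hi.2.1
  | ite_false _ _ h1 =>
      intro i hi
      simp only [Prog.bound, max_le_iff] at hi
      exact h1 i hi.2.2
  | loop_true _ _ _ h1 h2 =>
      intro i hi
      rw [h2 i hi]
      simp only [Prog.bound, max_le_iff] at hi
      exact h1 i hi.2
  | loop_false _ => intro i _; rfl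

/-- A run depends only on the variables that the program mentions. -/
theorem Exec.congr {N : ℕ} {p : Prog} {s s' : Store} {t : ℕ} (h : Exec p s t s') :
    p.bound ≤ N → ∀ r : Store, (∀ i < N, s i = r i) →
      ∃ r', Exec p r t r' ∧ ∀ i < N, s' i = r' i := by
  induction h with
  | skip s => intro _ r hr; exact ⟨r, .skip r, hr⟩
  | assign j e s =>
      intro hN r hr
      simp only [Prog.bound, max_le_iff] at hN
      refine ⟨_, .assign j e r, fun i hi => ?_⟩
      rw [Expr.eval_congr hr e hN.2]
      by_cases hij : i = j
      · subst hij; simp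
      · simp [Function.update_of_ne hij, hr i hi]
  | seq _ _ h1 h2 =>
      intro hN r hr
      simp only [Prog.bound, max_le_iff] at hN
      obtain ⟨r1, e1, g1⟩ := h1 hN.1 r hr
      obtain ⟨r2, e2, g2⟩ := h2 hN.2 r1 g1
      exact ⟨r2, e1.seq e2, g2⟩
  | ite_true hc _ h1 =>
      intro hN r hr
      simp only [Prog.bound, max_le_iff] at hN
      obtain ⟨r1, e1, g1⟩ := h1 hN.2.1 r hr
      exact ⟨r1, .ite_true (by rwa [← Expr.eval_congr hr _ hN.1]) e1, g1⟩
  | ite_false hc _ h1 =>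
      intro hN r hr
      simp only [Prog.bound, max_le_iff] at hN
      obtain ⟨r1, e1, g1⟩ := h1 hN.2.2 r hr
      exact ⟨r1, .ite_false (by rwa [← Expr.eval_congr hr _ hN.1]) e1, g1⟩
  | loop_true hc _ _ h1 h2 =>
      intro hN r hr
      have hN' := hN
      simp only [Prog.bound, max_le_iff] at hN
      obtain ⟨r1, e1, g1⟩ := h1 hN.2 r hr
      obtain ⟨r2, e2, g2⟩ := h2 hN' r1 g1
      exact ⟨r2, .loop_true (by rwa [← Expr.eval_congr hr _ hN.1]) e1 e2, g2⟩
  | loop_false hc =>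
      intro hN r hr
      simp only [Prog.bound, max_le_iff] at hN
      exact ⟨r, .loop_false (by rwa [← Expr.eval_congr hr _ hN.1]), hr⟩

/-- Set the variables `1, …, k` to `nil`. -/
def Prog.clear : ℕ → Prog
  | 0 => .skip
  | k + 1 => .seq (Prog.clear k) (.assign (k + 1) .nil)

theorem exec_clear (s : Store) : ∀ k : ℕ, ∃ s', Exec (Prog.clear k) s (2 * k + 1) s' ∧
    s' 0 = s 0 ∧ ∀ i, 1 ≤ i → i ≤ k → s' i = .nil
  | 0 => ⟨s, .skip s, rfl, fun i h1 h2 => by omega⟩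
  | k + 1 => by
      obtain ⟨s', h, h0, hk⟩ := exec_clear s k
      have e : Exec (Prog.clear (k + 1)) s (2 * (k + 1) + 1) _ :=
        .seq (t := 2 * k + 1) (u := 2) h (.assign (k + 1) .nil s')
      refine ⟨_, e, ?_, fun i h1 h2 => ?_⟩
      · rw [Function.update_of_ne (by omega), h0]
      · by_cases hi : i = k + 1
        · subst hi; simp [Expr.eval]
        · rw [Function.update_of_ne hi]; exact hk i h1 (by omega)

/-! ### Functions on trees that are computed within a given time -/

/-- Some program computes `f` on all inputs that satisfy `P`, within `T x` steps on the input `x`.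
Input and output are in variable `0`; nothing is assumed about the other variables, so that
such programs can be run one after the other. -/
def RunsIn (P : Val → Prop) (f : Val → Val) (T : Val → ℕ) : Prop :=
  ∃ p : Prog, ∀ s : Store, P (s 0) →
    ∃ (t : ℕ) (s' : Store), Exec p s t s' ∧ s' 0 = f (s 0) ∧ t ≤ T (s 0)

theorem RunsIn.mono {P P' : Val → Prop} {f : Val → Val} {T T' : Val → ℕ} (h : RunsIn P f T)
    (hP : ∀ x, P' x → P x) (hT : ∀ x, P' x → T x ≤ T' x) : RunsIn P' f T' := by
  obtain ⟨p, hp⟩ := h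
  refine ⟨p, fun s hs => ?_⟩
  obtain ⟨t, s', h1, h2, h3⟩ := hp s (hP _ hs)
  exact ⟨t, s', h1, h2, h3.trans (hT _ hs)⟩

/-- A program that is only known to work in the initial store can be made to work in every
store: its variables are cleared beforehand. -/
theorem RunsIn.of_outputs {P : Val → Prop} {f : Val → Val} {T : Val → ℕ} (p : Prog)
    (h : ∀ x, P x → ∃ t, p.Outputs x t (f x) ∧ t ≤ T x) :
    RunsIn P f (fun x => T x + (2 * p.bound + 1)) := by
  refine ⟨.seq (Prog.clear p.bound) p, fun s hs => ?_⟩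
  obtain ⟨s1, e1, h0, h1⟩ := exec_clear s p.bound
  obtain ⟨t, ⟨s2, e2, h2⟩, ht⟩ := h _ hs
  obtain ⟨s3, e3, h3⟩ := e2.congr (N := p.bound + 1) (by omega) s1 (by
    intro i hi
    by_cases hi0 : i = 0
    · subst hi0; simp [initStore, h0]
    · simp only [initStore, hi0, if_false]
      exact (h1 i (by omega) (by omega)).symm)
  exact ⟨_, s3, e1.seq e3, by rw [← h3 0 (by omega), h2], by dsimp only; omega⟩

theorem RunsIn.id (P : Val → Prop) : RunsIn P (fun x => x) (fun _ => 1) :=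
  ⟨.skip, fun s _ => ⟨_, s, .skip s, rfl, le_rfl⟩⟩

theorem RunsIn.nil (P : Val → Prop) : RunsIn P (fun _ => .nil) (fun _ => 2) :=
  ⟨.assign 0 .nil, fun s _ => ⟨_, _, .assign 0 .nil s, by simp [Expr.eval], le_rfl⟩⟩

theorem RunsIn.hd {P : Val → Prop} {f : Val → Val} {T : Val → ℕ} (h : RunsIn P f T) :
    RunsIn P (fun x => (f x).hd) (fun x => T x + 3) := by
  obtain ⟨p, hp⟩ := h
  refine ⟨.seq p (.assign 0 (.hd (.var 0))), fun s hs => ?_⟩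
  obtain ⟨t, s', h1, h2, h3⟩ := hp s hs
  exact ⟨_, _, h1.seq (.assign _ _ _), by simp [Expr.eval, h2], by simp [Expr.cost]; omega⟩

theorem RunsIn.tl {P : Val → Prop} {f : Val → Val} {T : Val → ℕ} (h : RunsIn P f T) :
    RunsIn P (fun x => (f x).tl) (fun x => T x + 3) := by
  obtain ⟨p, hp⟩ := h
  refine ⟨.seq p (.assign 0 (.tl (.var 0))), fun s hs => ?_⟩
  obtain ⟨t, s', h1, h2, h3⟩ := hp s hs
  exact ⟨_, _, h1.seq (.assign _ _ _), by simp [Expr.eval, h2], by simp [Expr.cost]; omega⟩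

theorem RunsIn.comp {P Q : Val → Prop} {f g : Val → Val} {T U : Val → ℕ} (hf : RunsIn Q f U)
    (hg : RunsIn P g T) (hQ : ∀ x, P x → Q (g x)) :
    RunsIn P (fun x => f (g x)) (fun x => T x + U (g x)) := by
  obtain ⟨p, hp⟩ := hg
  obtain ⟨q, hq⟩ := hf
  refine ⟨.seq p q, fun s hs => ?_⟩
  obtain ⟨t, s', h1, h2, h3⟩ := hp s hs
  obtain ⟨u, s'', k1, k2, k3⟩ := hq s' (by rw [h2]; exact hQ _ hs)
  refine ⟨_, s'', h1.seq k1, by rw [k2, h2], ?_⟩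
  rw [h2] at k3
  dsimp only
  omega

theorem RunsIn.cons {P : Val → Prop} {f g : Val → Val} {T U : Val → ℕ} (hf : RunsIn P f T)
    (hg : RunsIn P g U) :
    RunsIn P (fun x => .cons (f x) (g x)) (fun x => T x + U x + 10) := by
  obtain ⟨p, hp⟩ := hf
  obtain ⟨q, hq⟩ := hg
  obtain ⟨M, hM⟩ : ∃ M, M = max (max p.bound q.bound) 1 := ⟨_, rfl⟩
  refine ⟨.seq (.assign M (.var 0)) (.seq p (.seq (.assign (M + 1) (.var 0))
    (.seq (.assign 0 (.var M)) (.seq q (.assign 0 (.cons (.var (M + 1)) (.var 0))))))),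
    fun s hs => ?_⟩
  obtain ⟨t, s1, e1, h1, ht⟩ := hp (Function.update s M (s 0)) (by
    rwa [Function.update_of_ne (by omega)])
  rw [Function.update_of_ne (by omega)] at h1 ht
  have hM1 : s1 M = s 0 := by rw [e1.frame M (by omega)]; simp
  obtain ⟨s2, hs2⟩ : ∃ s2, s2 = Function.update (Function.update s1 (M + 1) (s1 0)) 0 (s 0) :=
    ⟨_, rfl⟩
  have h20 : s2 0 = s 0 := by simp [hs2]
  have h2M : s2 (M + 1) = f (s 0) := by
    rw [hs2, Function.update_of_ne (by omega)]; simp [h1]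
  obtain ⟨u, s3, e3, h3, hu⟩ := hq s2 (by rwa [h20])
  rw [h20] at h3 hu
  have h3M : s3 (M + 1) = f (s 0) := by rw [e3.frame _ (by omega), h2M]
  have a2 : Exec (.assign 0 (.var M)) (Function.update s1 (M + 1) (s1 0)) 2 s2 := by
    have := Exec.assign 0 (.var M) (Function.update s1 (M + 1) (s1 0))
    simpa [Expr.eval, Expr.cost, hs2, hM1] using this
  refine ⟨_, _, .seq (.assign M (.var 0) s) (.seq e1 (.seq (.assign (M + 1) (.var 0) s1)
    (.seq a2 (.seq e3 (.assign 0 _ s3))))), ?_, ?_⟩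
  · simp [Expr.eval, h3, h3M]
  · simp only [Expr.cost]; omega

/-- The test of the language: `nil` counts as false, every other tree as true. -/
def Val.test : Val → Bool
  | .nil => false
  | .cons _ _ => true

theorem Val.test_iff {x : Val} : x.test = true ↔ x ≠ .nil := by
  cases x <;> simp [Val.test]

@[simp] theorem Val.test_nil : Val.nil.test = false := rfl

@[simp] theorem Val.test_cons (a b : Val) : (Val.cons a b).test = true := rfl

@[simp] theorem Val.hd_cons (a b : Val) : (Val.cons a b).hd = a := rfl

@[simp] theorem Val.tl_cons (a b : Val) : (Val.cons a b).tl = b := rfl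

theorem RunsIn.ite {P : Val → Prop} {c f g : Val → Val} {S T U : Val → ℕ} (hc : RunsIn P c S)
    (hf : RunsIn P f T) (hg : RunsIn P g U) :
    RunsIn P (fun x => if (c x).test then f x else g x) (fun x => S x + T x + U x + 10) := by
  obtain ⟨r, hr⟩ := hc
  obtain ⟨p, hp⟩ := hf
  obtain ⟨q, hq⟩ := hg
  obtain ⟨M, hM⟩ : ∃ M, M = max r.bound 1 := ⟨_, rfl⟩
  refine ⟨.seq (.assign M (.var 0)) (.seq r (.ite (.var 0) (.seq (.assign 0 (.var M)) p)
    (.seq (.assign 0 (.var M)) q))), fun s hs => ?_⟩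
  obtain ⟨t, s1, e1, h1, ht⟩ := hr (Function.update s M (s 0)) (by
    rwa [Function.update_of_ne (by omega)])
  rw [Function.update_of_ne (by omega)] at h1 ht
  have hM1 : s1 M = s 0 := by rw [e1.frame M (by omega)]; simp
  obtain ⟨s2, hs2⟩ : ∃ s2, s2 = Function.update s1 0 (s 0) := ⟨_, rfl⟩
  have h20 : s2 0 = s 0 := by simp [hs2]
  have a2 : Exec (.assign 0 (.var M)) s1 2 s2 := by
    have := Exec.assign 0 (.var M) s1
    simpa [Expr.eval, Expr.cost, hs2, hM1] using this
  by_cases hcx : c (s 0) = .nil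
  · obtain ⟨u, s3, e3, h3, hu⟩ := hq s2 (by rwa [h20])
    rw [h20] at h3 hu
    refine ⟨_, _, .seq (.assign M (.var 0) s) (.seq e1 (.ite_false ?_ (.seq a2 e3))), ?_, ?_⟩
    · simp [Expr.eval, h1, hcx]
    · simp [h3, hcx, Val.test]
    · simp only [Expr.cost]; omega
  · obtain ⟨u, s3, e3, h3, hu⟩ := hp s2 (by rwa [h20])
    rw [h20] at h3 hu
    refine ⟨_, _, .seq (.assign M (.var 0) s) (.seq e1 (.ite_true ?_ (.seq a2 e3))), ?_, ?_⟩
    · simp [Expr.eval, h1, hcx]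
    · simp [h3, Val.test_iff.2 hcx]
    · simp only [Expr.cost]; omega

/-- The list whose elements are the left subtrees along the rightmost path; every tree is the
representation of exactly one list of trees. -/
def Val.toList : Val → List Val
  | .nil => []
  | .cons a b => a :: b.toList

/-- The tree that represents a list of trees. -/
def Val.ofList : List Val → Val
  | [] => .nil
  | a :: l => .cons a (Val.ofList l)

@[simp] theorem Val.toList_ofList : ∀ l : List Val, (Val.ofList l).toList = l
  | [] => rfl
  | a :: l => by rw [Val.ofList, Val.toList, toList_ofList l]

@[simp] theorem Val.ofList_toList : ∀ x : Val, Val.ofList x.toList = x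
  | .nil => rfl
  | .cons a b => by rw [Val.toList, Val.ofList, ofList_toList b]

theorem encodeList_eq {α : Type} (f : α → Val) : ∀ l : List α,
    encodeList f l = Val.ofList (l.map f)
  | [] => rfl
  | a :: l => by rw [encodeList, encodeList_eq f l]; rfl

/-- Folding over a list. The step sees the input `x`, an element and the accumulator. The
invariant `Inv x l acc` speaks of the elements `l` that remain. -/
theorem RunsIn.foldl {P Q : Val → Prop} {g h : Val → Val} {F : Val → Val → Val → Val}
    {T U S B : Val → ℕ}
    (hg : RunsIn P g T) (hh : RunsIn P h U)
    (hF : RunsIn Q (fun y => F y.hd y.tl.hd y.tl.tl) S)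
    (Inv : Val → List Val → Val → Prop)
    (h0 : ∀ x, P x → Inv x (h x).toList (g x))
    (hs : ∀ x, P x → ∀ a l acc, a :: l <:+ (h x).toList → Inv x (a :: l) acc →
      Q (.cons x (.cons a acc)) ∧ S (.cons x (.cons a acc)) ≤ B x ∧ Inv x l (F x a acc)) :
    RunsIn P (fun x => (h x).toList.foldl (fun acc a => F x a acc) (g x))
      (fun x => T x + U x + (h x).toList.length * (B x + 20) + 40) := by
  obtain ⟨p, hp⟩ := hF
  obtain ⟨q, hq⟩ := RunsIn.cons (RunsIn.id P) (RunsIn.cons hh hg)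
  obtain ⟨M, hM⟩ : ∃ M, M = max p.bound 1 := ⟨_, rfl⟩
  -- the input is kept in `M`, the rest of the list in `M + 1`, the accumulator in `M + 2`
  let body : Prog := .seq (.assign 0 (.cons (.var M) (.cons (.hd (.var (M + 1))) (.var (M + 2)))))
    (.seq p (.seq (.assign (M + 2) (.var 0)) (.assign (M + 1) (.tl (.var (M + 1))))))
  have key : ∀ x, P x → ∀ (z : Val) (s : Store), z.toList <:+ (h x).toList →
      Inv x z.toList (s (M + 2)) → s M = x → s (M + 1) = z →
      ∃ t s', Exec (.loop (.var (M + 1)) body) s t s' ∧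
        s' (M + 2) = z.toList.foldl (fun acc a => F x a acc) (s (M + 2)) ∧
        t ≤ z.toList.length * (B x + 20) + 2 := by
    intro x hx z
    induction z with
    | nil =>
      intro s _ _ _ h1
      exact ⟨_, s, .loop_false (by simpa [Expr.eval] using h1), rfl, by simp [Expr.cost]⟩
    | cons a z _ ih =>
      intro s hz hI hsM h1
      obtain ⟨hQ, hS, hI'⟩ := hs x hx a z.toList (s (M + 2)) hz hI
      obtain ⟨s1, hs1⟩ : ∃ s1, s1 = Function.update s 0 (.cons x (.cons a (s (M + 2)))) :=
        ⟨_, rfl⟩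
      have a1 := Exec.assign 0 (.cons (.var M) (.cons (.hd (.var (M + 1))) (.var (M + 2)))) s
      simp only [Expr.eval, hsM, h1, Val.hd, ← hs1] at a1
      have h10 : s1 0 = .cons x (.cons a (s (M + 2))) := by simp [hs1]
      obtain ⟨t, s2, e2, h2, ht⟩ := hp s1 (by rw [h10]; exact hQ)
      rw [h10] at h2 ht
      simp only [Val.hd, Val.tl] at h2
      have h2M : s2 M = x := by
        rw [e2.frame _ (by omega), hs1, Function.update_of_ne (by omega), hsM]
      have h2M1 : s2 (M + 1) = .cons a z := by
        rw [e2.frame _ (by omega), hs1, Function.update_of_ne (by omega), h1]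
      obtain ⟨s3, hs3⟩ : ∃ s3, s3 = Function.update s2 (M + 2) (s2 0) := ⟨_, rfl⟩
      have a3 := Exec.assign (M + 2) (.var 0) s2
      simp only [Expr.eval, ← hs3] at a3
      have h3M1 : s3 (M + 1) = .cons a z := by
        rw [hs3, Function.update_of_ne (by omega), h2M1]
      obtain ⟨s4, hs4⟩ : ∃ s4, s4 = Function.update s3 (M + 1) z := ⟨_, rfl⟩
      have a4 := Exec.assign (M + 1) (.tl (.var (M + 1))) s3
      simp only [Expr.eval, h3M1, Val.tl, ← hs4] at a4
      have h4 : s4 (M + 2) = F x a (s (M + 2)) := by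
        rw [hs4, Function.update_of_ne (by omega), hs3, Function.update_self, h2]
      obtain ⟨u, s5, e5, h5, hu⟩ := ih s4 ((List.suffix_cons a _).trans hz) (by rwa [h4])
        (by rw [hs4, Function.update_of_ne (by omega), hs3, Function.update_of_ne (by omega), h2M])
        (by simp [hs4])
      refine ⟨_, s5, .loop_true (by simp [Expr.eval, h1]) (.seq a1 (.seq e2 (.seq a3 a4))) e5,
        ?_, ?_⟩
      · rw [h5, h4]; rfl
      · simp only [Expr.cost, Val.toList, List.length_cons, add_mul, one_mul]
        omega
  refine ⟨.seq q (.seq (.assign M (.hd (.var 0))) (.seq (.assign (M + 1) (.hd (.tl (.var 0))))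
    (.seq (.assign (M + 2) (.tl (.tl (.var 0)))) (.seq (.loop (.var (M + 1)) body)
      (.assign 0 (.var (M + 2))))))), fun s hx => ?_⟩
  obtain ⟨t, s1, e1, h1, ht⟩ := hq s hx
  obtain ⟨s2, hs2⟩ : ∃ s2, s2 = Function.update s1 M (s 0) := ⟨_, rfl⟩
  have a2 := Exec.assign M (.hd (.var 0)) s1
  simp only [Expr.eval, h1, Val.hd, ← hs2] at a2
  have h20 : s2 0 = s1 0 := by rw [hs2, Function.update_of_ne (by omega)]
  obtain ⟨s3, hs3⟩ : ∃ s3, s3 = Function.update s2 (M + 1) (h (s 0)) := ⟨_, rfl⟩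
  have a3 := Exec.assign (M + 1) (.hd (.tl (.var 0))) s2
  simp only [Expr.eval, h20, h1, Val.hd, Val.tl, ← hs3] at a3
  have h30 : s3 0 = s1 0 := by rw [hs3, Function.update_of_ne (by omega), h20]
  obtain ⟨s4, hs4⟩ : ∃ s4, s4 = Function.update s3 (M + 2) (g (s 0)) := ⟨_, rfl⟩
  have a4 := Exec.assign (M + 2) (.tl (.tl (.var 0))) s3
  simp only [Expr.eval, h30, h1, Val.tl, ← hs4] at a4
  have h42 : s4 (M + 2) = g (s 0) := by simp [hs4]
  obtain ⟨u, s5, e5, h5, hu⟩ := key (s 0) hx (h (s 0)) s4 (List.suffix_refl _)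
    (by rw [h42]; exact h0 _ hx)
    (by rw [hs4, Function.update_of_ne (by omega), hs3, Function.update_of_ne (by omega), hs2,
      Function.update_self])
    (by rw [hs4, Function.update_of_ne (by omega), hs3, Function.update_self])
  refine ⟨_, _, .seq e1 (.seq a2 (.seq a3 (.seq a4 (.seq e5 (.assign 0 _ s5))))), ?_, ?_⟩
  · simp [Expr.eval, h5, h42]
  · dsimp only at ht ⊢; simp only [Expr.cost]; omega

end WhileLang

namespace WhileLang

/-! ### Polynomial time -/

/-- The number of nodes of a tree. -/
def Val.size : Val → ℕ
  | .nil => 1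
  | .cons a b => a.size + b.size + 1

theorem Val.size_pos : ∀ x : Val, 0 < x.size
  | .nil => by simp [Val.size]
  | .cons _ _ => by simp [Val.size]

theorem Val.size_hd_le : ∀ x : Val, x.hd.size ≤ x.size
  | .nil => le_rfl
  | .cons _ _ => by simp only [Val.hd, Val.size]; omega

theorem Val.size_tl_le : ∀ x : Val, x.tl.size ≤ x.size
  | .nil => le_rfl
  | .cons _ _ => by simp only [Val.tl, Val.size]; omega

theorem Val.length_toList_lt : ∀ x : Val, x.toList.length < x.size
  | .nil => by simp [Val.toList, Val.size]
  | .cons a b => by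
      have := length_toList_lt b
      simp only [Val.toList, Val.size, List.length_cons]; omega

theorem Val.size_lt_of_mem : ∀ {x a : Val}, a ∈ x.toList → a.size < x.size
  | .nil, _, h => by simp [Val.toList] at h
  | .cons b y, a, h => by
      simp only [Val.toList, List.mem_cons] at h
      rcases h with rfl | h
      · simp only [Val.size]; omega
      · have := size_lt_of_mem h
        simp only [Val.size]; omega

theorem Val.size_ofList : ∀ l : List Val, (Val.ofList l).size = (l.map fun a => a.size + 1).sum + 1
  | [] => rfl
  | a :: l => by simp [Val.ofList, Val.size, size_ofList l]; omega

/-- Bounded by a polynomial in the size of the argument. -/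
def PolyBounded (g : Val → ℕ) : Prop :=
  ∃ k : ℕ, ∀ x : Val, g x ≤ (x.size + 2) ^ k

namespace PolyBounded

theorem mono {g g' : Val → ℕ} (h : PolyBounded g) (hg : ∀ x, g' x ≤ g x) : PolyBounded g' := by
  obtain ⟨k, hk⟩ := h
  exact ⟨k, fun x => (hg x).trans (hk x)⟩

theorem const (c : ℕ) : PolyBounded fun _ => c :=
  ⟨c, fun x => (Nat.lt_two_pow_self (n := c)).le.trans (Nat.pow_le_pow_left (by omega) c)⟩

theorem size : PolyBounded Val.size := ⟨1, fun x => by rw [pow_one]; omega⟩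

theorem mul {g h : Val → ℕ} (hg : PolyBounded g) (hh : PolyBounded h) :
    PolyBounded fun x => g x * h x := by
  obtain ⟨i, hi⟩ := hg
  obtain ⟨j, hj⟩ := hh
  exact ⟨i + j, fun x => by rw [pow_add]; exact Nat.mul_le_mul (hi x) (hj x)⟩

theorem add {g h : Val → ℕ} (hg : PolyBounded g) (hh : PolyBounded h) :
    PolyBounded fun x => g x + h x := by
  obtain ⟨i, hi⟩ := hg
  obtain ⟨j, hj⟩ := hh
  refine ⟨max i j + 1, fun x => ?_⟩
  have h1 : (x.size + 2) ^ i ≤ (x.size + 2) ^ max i j :=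
    Nat.pow_le_pow_right (by omega) (le_max_left _ _)
  have h2 : (x.size + 2) ^ j ≤ (x.size + 2) ^ max i j :=
    Nat.pow_le_pow_right (by omega) (le_max_right _ _)
  have h3 : (x.size + 2) ^ max i j * 2 ≤ (x.size + 2) ^ (max i j + 1) := by
    rw [pow_succ]; exact Nat.mul_le_mul_left _ (by omega)
  have := hi x
  have := hj x
  dsimp only
  omega

theorem pow {g : Val → ℕ} (hg : PolyBounded g) (k : ℕ) : PolyBounded fun x => g x ^ k := by
  obtain ⟨i, hi⟩ := hg
  exact ⟨i * k, fun x => by rw [pow_mul]; exact Nat.pow_le_pow_left (hi x) k⟩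

theorem comp {g : Val → ℕ} {f : Val → Val} (hg : PolyBounded g)
    (hf : PolyBounded fun x => (f x).size) : PolyBounded fun x => g (f x) := by
  obtain ⟨k, hk⟩ := hg
  exact ((hf.add (const 2)).pow k).mono fun x => hk _

end PolyBounded

/-- Computable in polynomial time, with outputs of polynomial size. The second condition does not
follow from the first one, since `cons` shares its arguments: the size of a tree can be exponential
in the number of steps that build it. -/
def PolyTime (f : Val → Val) : Prop :=
  (PolyBounded fun x => (f x).size) ∧
    ∃ T : Val → ℕ, PolyBounded T ∧ RunsIn (fun _ => True) f T

namespace PolyTime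

theorem id : PolyTime fun x => x :=
  ⟨.size, _, .const 1, .id _⟩

theorem nil : PolyTime fun _ => .nil :=
  ⟨.const 1, _, .const 2, .nil _⟩

theorem hd {f : Val → Val} (hf : PolyTime f) : PolyTime fun x => (f x).hd := by
  obtain ⟨h1, T, h2, h3⟩ := hf
  exact ⟨h1.mono fun x => Val.size_hd_le _, _, h2.add (.const 3), h3.hd⟩

theorem tl {f : Val → Val} (hf : PolyTime f) : PolyTime fun x => (f x).tl := by
  obtain ⟨h1, T, h2, h3⟩ := hf
  exact ⟨h1.mono fun x => Val.size_tl_le _, _, h2.add (.const 3), h3.tl⟩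

theorem cons {f g : Val → Val} (hf : PolyTime f) (hg : PolyTime g) :
    PolyTime fun x => .cons (f x) (g x) := by
  obtain ⟨h1, T, h2, h3⟩ := hf
  obtain ⟨k1, U, k2, k3⟩ := hg
  exact ⟨(h1.add k1).add (.const 1), _, (h2.add k2).add (.const 10), h3.cons k3⟩

theorem hd' : PolyTime fun x => x.hd := id.hd

theorem tl' : PolyTime fun x => x.tl := id.tl

theorem comp {f g : Val → Val} (hf : PolyTime f) (hg : PolyTime g) :
    PolyTime fun x => f (g x) := by
  obtain ⟨h1, T, h2, h3⟩ := hf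
  obtain ⟨k1, U, k2, k3⟩ := hg
  exact ⟨h1.comp k1, _, k2.add (h2.comp k1), h3.comp k3 fun _ _ => trivial⟩

theorem const : ∀ c : Val, PolyTime fun _ => c
  | .nil => nil
  | .cons a b => (const a).cons (const b)

/-- Functions of two arguments take them as a pair. -/
theorem comp₂ {F : Val → Val → Val} {f g : Val → Val} (hF : PolyTime fun y => F y.hd y.tl)
    (hf : PolyTime f) (hg : PolyTime g) : PolyTime fun x => F (f x) (g x) :=
  hF.comp (hf.cons hg)

theorem ite {c f g : Val → Val} (hc : PolyTime c) (hf : PolyTime f) (hg : PolyTime g) :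
    PolyTime fun x => if (c x).test then f x else g x := by
  obtain ⟨h1, T, h2, h3⟩ := hf
  obtain ⟨k1, U, k2, k3⟩ := hg
  obtain ⟨-, S, l2, l3⟩ := hc
  refine ⟨(h1.add k1).mono fun x => ?_, _, ((l2.add h2).add k2).add (.const 10), l3.ite h3 k3⟩
  dsimp only
  split_ifs <;> omega

theorem size_foldl_le (F : Val → Val → Val) (Q : ℕ) : ∀ (l : List Val) (b : Val),
    (∀ a ∈ l, ∀ acc, (F a acc).size ≤ acc.size + Q) →
    (l.foldl (fun acc a => F a acc) b).size ≤ b.size + l.length * Q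
  | [], b, _ => by simp
  | a :: l, b, h => by
      have h1 := size_foldl_le F Q l (F a b) fun c hc => h c (List.mem_cons_of_mem _ hc)
      have h2 := h a List.mem_cons_self b
      simp only [List.foldl_cons, List.length_cons, add_mul, one_mul]
      omega

/-- A fold whose accumulator grows by a polynomial amount in every step is computable in
polynomial time. -/
theorem foldl {g h : Val → Val} {F : Val → Val → Val → Val} (hg : PolyTime g) (hh : PolyTime h)
    (hF : PolyTime fun y => F y.hd y.tl.hd y.tl.tl)
    (hb : ∃ k, ∀ x a acc, (F x a acc).size ≤ acc.size + (x.size + a.size + 2) ^ k) :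
    PolyTime fun x => (h x).toList.foldl (fun acc a => F x a acc) (g x) := by
  obtain ⟨hg1, Tg, hg2, hg3⟩ := hg
  obtain ⟨hh1, Th, hh2, hh3⟩ := hh
  obtain ⟨-, TF, ⟨m, hm⟩, hF3⟩ := hF
  obtain ⟨k, hk⟩ := hb
  obtain ⟨Q, hQ⟩ : ∃ Q : Val → ℕ, Q = fun x => (x.size + (h x).size + 2) ^ k := ⟨_, rfl⟩
  have hQP : PolyBounded Q := hQ ▸ ((PolyBounded.size.add hh1).add (.const 2)).pow k
  have hlen : PolyBounded fun x => (h x).toList.length :=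
    hh1.mono fun x => (Val.length_toList_lt _).le
  have hstep : ∀ x a acc, a ∈ (h x).toList → (F x a acc).size ≤ acc.size + Q x := by
    intro x a acc ha
    refine (hk x a acc).trans ?_
    have := Val.size_lt_of_mem ha
    rw [hQ]
    exact Nat.add_le_add_left (Nat.pow_le_pow_left (by omega) k) _
  have hacc := hg1.add (hlen.mul hQP)
  have hB := ((((PolyBounded.size.add hh1).add hacc).add (.const 4)).pow m)
  refine ⟨hacc.mono fun x => size_foldl_le (F x) (Q x) _ _ fun a ha acc => hstep x a acc ha,
    _, ?_, RunsIn.foldl hg3 hh3 hF3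
      (fun x l acc => acc.size + l.length * Q x ≤ (g x).size + (h x).toList.length * Q x)
      (B := fun x => (x.size + (h x).size + ((g x).size + (h x).toList.length * Q x) + 4) ^ m)
      (fun _ _ => le_rfl) ?_⟩
  · exact ((hg2.add hh2).add (hlen.mul (hB.add (.const 20)))).add (.const 40)
  · intro x _ a l acc hl hI
    have ha : a ∈ (h x).toList := hl.subset List.mem_cons_self
    have h1 := hstep x a acc ha
    have h2 := Val.size_lt_of_mem ha
    simp only [List.length_cons, add_mul, one_mul] at hI
    refine ⟨trivial, (hm _).trans (Nat.pow_le_pow_left ?_ m), by omega⟩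
    simp only [Val.size]
    omega

end PolyTime

/-! ### List processing in polynomial time -/

namespace PolyTime

theorem pow_le_pow_sq {s k : ℕ} : (s + 3) ^ k ≤ (s + 2) ^ (2 * k) := by
  rw [pow_mul]
  exact Nat.pow_le_pow_left (by nlinarith) k

theorem reverse {h : Val → Val} (hh : PolyTime h) :
    PolyTime fun x => Val.ofList (h x).toList.reverse := by
  have key : PolyTime fun x => (h x).toList.foldl (fun acc a => (fun _ a acc => Val.cons a acc)
      x a acc) .nil :=
    foldl (F := fun _ a acc => Val.cons a acc) nil hh (id.tl.hd.cons id.tl.tl)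
      ⟨1, fun x a acc => by simp only [Val.size, pow_one]; omega⟩
  have aux : ∀ (l m : List Val), l.foldl (fun acc a => Val.cons a acc) (Val.ofList m) =
      Val.ofList (l.reverse ++ m) := by
    intro l
    induction l with
    | nil => intro m; rfl
    | cons a l ih =>
      intro m
      have := ih (a :: m)
      simpa [Val.ofList] using this
  refine cast (congrArg PolyTime (funext fun x => ?_)) key
  have := aux (h x).toList []
  rwa [List.append_nil] at this

theorem foldr {g h : Val → Val} {F : Val → Val → Val → Val} (hg : PolyTime g) (hh : PolyTime h)
    (hF : PolyTime fun y => F y.hd y.tl.hd y.tl.tl)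
    (hb : ∃ k, ∀ x a acc, (F x a acc).size ≤ acc.size + (x.size + a.size + 2) ^ k) :
    PolyTime fun x => (h x).toList.foldr (F x) (g x) := by
  refine cast (congrArg PolyTime (funext fun x => ?_)) (foldl hg hh.reverse hF hb)
  simp

theorem map {h : Val → Val} {G : Val → Val → Val} (hh : PolyTime h)
    (hG : PolyTime fun y => G y.hd y.tl) :
    PolyTime fun x => Val.ofList ((h x).toList.map (G x)) := by
  obtain ⟨k, hk⟩ := hG.1
  have key : PolyTime fun x => (h x).toList.foldr (fun a acc => Val.cons (G x a) acc) .nil := by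
    refine foldr (F := fun x a acc => Val.cons (G x a) acc) nil hh
      ((hG.comp (f := fun y => G y.hd y.tl) (g := fun y => .cons y.hd y.tl.hd)
        (id.hd.cons id.tl.hd)).cons id.tl.tl) ⟨2 * k + 1, fun x a acc => ?_⟩
    have h1 := hk (.cons x a)
    simp only [Val.size, Val.hd, Val.tl] at h1 ⊢
    have h2 : (x.size + a.size + 3) ^ k ≤ (x.size + a.size + 2) ^ (2 * k) := pow_le_pow_sq
    have h3 : 1 ≤ (x.size + a.size + 2) ^ (2 * k) := Nat.one_le_pow _ _ (by omega)
    have h4 : (x.size + a.size + 2) ^ (2 * k) * 2 ≤ (x.size + a.size + 2) ^ (2 * k + 1) := by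
      rw [pow_succ]; exact Nat.mul_le_mul_left _ (by omega)
    have h5 : x.size + a.size + 1 + 2 = x.size + a.size + 3 := by omega
    rw [h5] at h1
    omega
  refine cast (congrArg PolyTime (funext fun x => ?_)) key
  induction (h x).toList with
  | nil => rfl
  | cons a l ih => simp [Val.ofList, ih]

theorem filter {h : Val → Val} {p : Val → Val → Val} (hh : PolyTime h)
    (hp : PolyTime fun y => p y.hd y.tl) :
    PolyTime fun x => Val.ofList ((h x).toList.filter fun a => (p x a).test) := by
  have key : PolyTime fun x => (h x).toList.foldr
      (fun a acc => if (p x a).test then Val.cons a acc else acc) .nil := by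
    refine foldr (F := fun x a acc => if (p x a).test then Val.cons a acc else acc) nil hh
      (ite (hp.comp (f := fun y => p y.hd y.tl) (g := fun y => .cons y.hd y.tl.hd)
        (id.hd.cons id.tl.hd)) (id.tl.hd.cons id.tl.tl) id.tl.tl) ⟨1, fun x a acc => ?_⟩
    split_ifs
    · simp only [Val.size, pow_one]; omega
    · omega
  refine cast (congrArg PolyTime (funext fun x => ?_)) key
  induction (h x).toList with
  | nil => rfl
  | cons a l ih =>
    by_cases ha : (p x a).test = true <;> simp [ha, Val.ofList, ih]

theorem append {f g : Val → Val} (hf : PolyTime f) (hg : PolyTime g) :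
    PolyTime fun x => Val.ofList ((f x).toList ++ (g x).toList) := by
  refine cast (congrArg PolyTime (funext fun x => ?_))
    (foldr (F := fun _ a acc => .cons a acc) hg hf (id.tl.hd.cons id.tl.tl)
      ⟨1, fun x a acc => by simp only [Val.size, pow_one]; omega⟩)
  induction (f x).toList with
  | nil => simp
  | cons a l ih => simp [Val.ofList, ih]

end PolyTime

/-- `popMap c o l q`: for every element `a` of `l`, the list contains `o a b`, where `b` is the
first element of the queue `q`; the element `b` is removed from the queue if `c a` holds. -/
def popMap (c : Val → Bool) (o : Val → Val → Val) : List Val → Val → List Val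
  | [], _ => []
  | a :: l, q => o a q.hd :: popMap c o l (if c a then q.tl else q)

theorem PolyTime.popMap {f g : Val → Val} {c : Val → Val} {o : Val → Val → Val}
    (hf : PolyTime f) (hg : PolyTime g) (hc : PolyTime c) (ho : PolyTime fun y => o y.hd y.tl)
    (hsize : ∀ a b, (o a b).size ≤ a.size + (if (c a).test then b.size else 0) + 1) :
    PolyTime fun x => Val.ofList (popMap (fun a => (c a).test) o (f x).toList (g x)) := by
  -- the accumulator is the pair of the queue and the reversed output
  obtain ⟨F, hF⟩ : ∃ F : Val → Val → Val → Val, F = fun _ a acc =>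
    .cons (if (c a).test then acc.hd.tl else acc.hd) (.cons (o a acc.hd.hd) acc.tl) := ⟨_, rfl⟩
  have key : PolyTime fun x => (f x).toList.foldl (fun acc a => F x a acc) (.cons (g x) .nil) := by
    refine foldl (F := F) (hg.cons nil) hf ?_ ⟨2, fun x a acc => ?_⟩
    · rw [hF]
      exact (ite (hc.comp id.tl.hd) id.tl.tl.hd.tl id.tl.tl.hd).cons
        ((ho.comp (f := fun y => o y.hd y.tl) (g := fun y => .cons y.tl.hd y.tl.tl.hd.hd)
          (id.tl.hd.cons id.tl.tl.hd.hd)).cons id.tl.tl.tl)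
    · have h0 : 4 * (x.size + a.size + 2) ≤ (x.size + a.size + 2) ^ 2 := by
        have := Val.size_pos x
        have := Val.size_pos a
        nlinarith
      refine le_trans ?_ (Nat.add_le_add_left h0 _)
      have h1 := hsize a acc.hd.hd
      rw [hF]
      rcases acc with _ | ⟨_ | ⟨b, q⟩, out⟩ <;>
        simp only [Val.hd, Val.tl, Val.size] at * <;>
        split_ifs at * <;> (try simp only [Val.size] at *) <;> omega
  have aux : ∀ x (l : List Val) (q out : Val), (l.foldl (fun acc a => F x a acc) (.cons q out)).tl =
      Val.ofList ((WhileLang.popMap (fun a => (c a).test) o l q).reverse ++ out.toList) := by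
    intro x l
    induction l with
    | nil => intro q out; simp [WhileLang.popMap, Val.tl]
    | cons a l ih =>
      intro q out
      rw [List.foldl_cons]
      have : F x a (.cons q out) = .cons (if (c a).test then q.tl else q) (.cons (o a q.hd) out) := by
        rw [hF]; rfl
      rw [this, ih]
      simp [WhileLang.popMap, Val.toList]
  refine cast (congrArg PolyTime (funext fun x => ?_)) key.tl.reverse
  rw [aux]
  simp [Val.toList]

end WhileLang

namespace WhileLang

/-! ### Unary arithmetic -/

/-- The number that a list represents in unary. -/
abbrev Val.len (x : Val) : ℕ := x.toList.length

/-- The unary numeral `1`, which is also the encoding of `true`. -/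
abbrev Val.one : Val := .cons .nil .nil

@[simp] theorem Val.len_one : Val.one.len = 1 := rfl

theorem len_tl (x : Val) : x.tl.len = x.len - 1 := by
  rcases x with _ | ⟨a, b⟩ <;> simp [Val.len, Val.tl, Val.toList]

theorem test_eq_len (x : Val) : x.test = decide (0 < x.len) := by
  rcases x with _ | ⟨a, b⟩ <;> simp [Val.len, Val.test, Val.toList]

/-- The list `b` without its first `len a` elements: a nonempty list if and only if
`len a < len b`. -/
def dropLen (a b : Val) : Val := a.toList.foldl (fun acc _ => acc.tl) b

theorem polyTime_dropLen : PolyTime fun y => dropLen y.hd y.tl :=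
  PolyTime.foldl (F := fun _ _ acc => acc.tl) .tl' .hd' PolyTime.id.tl.tl.tl
    ⟨0, fun _ _ acc => (Val.size_tl_le acc).trans (Nat.le_add_right _ _)⟩

theorem test_dropLen (a b : Val) : (dropLen a b).test = decide (a.len < b.len) := by
  have key : ∀ (l : List Val) (b : Val),
      (l.foldl (fun acc _ => acc.tl) b).len = b.len - l.length := by
    intro l
    induction l with
    | nil => intro b; simp
    | cons a l ih => intro b; rw [List.foldl_cons, ih, len_tl, List.length_cons]; omega
  rw [test_eq_len, dropLen, key]
  exact decide_eq_decide.2 (by unfold Val.len; omega)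

/-- The sum of two unary numerals. -/
def addLen (a b : Val) : Val := .ofList (a.toList ++ b.toList)

theorem polyTime_addLen : PolyTime fun y => addLen y.hd y.tl :=
  PolyTime.append .hd' .tl'

@[simp] theorem len_addLen (a b : Val) : (addLen a b).len = a.len + b.len := by
  simp [addLen, Val.len]

/-- The product of two unary numerals. -/
def mulLen (a b : Val) : Val := a.toList.foldr (fun _ acc => addLen b acc) .nil

theorem size_addLen (a b : Val) : (addLen a b).size + 1 = a.size + b.size := by
  obtain ⟨l, rfl⟩ : ∃ l, a = Val.ofList l := ⟨_, (Val.ofList_toList a).symm⟩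
  obtain ⟨m, rfl⟩ : ∃ l, b = Val.ofList l := ⟨_, (Val.ofList_toList b).symm⟩
  simp [addLen, Val.size_ofList]; omega

theorem polyTime_mulLen : PolyTime fun y => mulLen y.hd y.tl :=
  PolyTime.foldr (F := fun x _ acc => addLen x.tl acc) .nil .hd'
    (polyTime_addLen.comp₂ PolyTime.id.hd.tl PolyTime.id.tl.tl) ⟨1, fun x a acc => by
      have := size_addLen x.tl acc
      have := Val.size_tl_le x
      simp only [pow_one]; omega⟩

@[simp] theorem len_mulLen (a b : Val) : (mulLen a b).len = a.len * b.len := by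
  unfold mulLen
  rw [Val.len.eq_def a]
  induction a.toList with
  | nil => simp [Val.len, Val.toList]
  | cons c l ih => rw [List.foldr_cons, len_addLen, ih, List.length_cons]; ring

/-- A fixed power of a unary numeral. -/
def powLen (a : Val) : ℕ → Val
  | 0 => .one
  | e + 1 => mulLen (powLen a e) a

theorem polyTime_powLen {f : Val → Val} (hf : PolyTime f) : ∀ e : ℕ,
    PolyTime fun x => powLen (f x) e
  | 0 => .const _
  | e + 1 => polyTime_mulLen.comp₂ (polyTime_powLen hf e) hf

@[simp] theorem len_powLen (a : Val) : ∀ e : ℕ, (powLen a e).len = a.len ^ e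
  | 0 => rfl
  | e + 1 => by rw [powLen, len_mulLen, len_powLen a e, pow_succ]

/-- The least number `r ≥ 1` with `len x ≤ r ^ e`, in unary (for `e ≥ 1`). -/
def rootLen (e : ℕ) (x : Val) : Val :=
  x.toList.foldl (fun acc _ => if (dropLen (powLen acc e) x).test then .cons .nil acc else acc) .one

theorem polyTime_rootLen (e : ℕ) : PolyTime (rootLen e) :=
  PolyTime.foldl
    (F := fun x _ acc => if (dropLen (powLen acc e) x).test then .cons .nil acc else acc)
    (.const _) .id
    (.ite (polyTime_dropLen.comp₂ (polyTime_powLen PolyTime.id.tl.tl e) .hd')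
      (.cons .nil PolyTime.id.tl.tl) PolyTime.id.tl.tl) ⟨1, fun x a acc => by
      split_ifs <;> simp only [Val.size, pow_one] <;> omega⟩

theorem rootLen_spec {e : ℕ} (he : 1 ≤ e) (x : Val) :
    1 ≤ (rootLen e x).len ∧ x.len ≤ (rootLen e x).len ^ e ∧
      ((rootLen e x).len = 1 ∨ ((rootLen e x).len - 1) ^ e < x.len) := by
  have key : ∀ (l : List Val) (b : Val), 1 ≤ b.len → (b.len = 1 ∨ (b.len - 1) ^ e < x.len) →
      ∃ r : Val, r = l.foldl (fun acc _ =>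
        if (dropLen (powLen acc e) x).test then .cons .nil acc else acc) b ∧ 1 ≤ r.len ∧
        (r.len = 1 ∨ (r.len - 1) ^ e < x.len) ∧ (x.len ≤ r.len ^ e ∨ b.len + l.length ≤ r.len) := by
    intro l
    induction l with
    | nil => intro b h1 h2; exact ⟨b, rfl, h1, h2, Or.inr le_rfl⟩
    | cons a l ih =>
      intro b h1 h2
      rw [List.foldl_cons, test_dropLen, len_powLen]
      by_cases hb : b.len ^ e < x.len
      · obtain ⟨r, hr, h3, h4, h5⟩ := ih (.cons .nil b) (by simp [Val.len, Val.toList])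
          (Or.inr (by simpa [Val.len, Val.toList] using hb))
        refine ⟨r, by simpa [hb] using hr, h3, h4, h5.imp_right fun h => ?_⟩
        simp only [Val.len, Val.toList, List.length_cons] at h ⊢
        omega
      · obtain ⟨r, hr, h3, h4, h5⟩ := ih b h1 h2
        refine ⟨r, by simpa [hb] using hr, h3, h4, h5.elim Or.inl fun h => Or.inl ?_⟩
        exact (not_lt.1 hb).trans (Nat.pow_le_pow_left (by omega) e)
  obtain ⟨r, hr, h3, h4, h5⟩ := key x.toList .one le_rfl (Or.inl rfl)
  have : rootLen e x = r := hr.symm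
  rw [this]
  refine ⟨h3, h5.elim id fun h => ?_, h4⟩
  have h6 : x.len ≤ r.len := by simp only [Val.len_one] at h; unfold Val.len at *; omega
  exact h6.trans (Nat.le_self_pow (by omega) _)

/-! ### Operations on characteristic vectors -/

/-- The list of the pairs of the elements of two lists of the same length. -/
def zipVal (a b : Val) : Val := .ofList (popMap (fun _ => true) .cons a.toList b)

theorem polyTime_zipVal : PolyTime fun y => zipVal y.hd y.tl :=
  PolyTime.popMap (c := fun _ => .one) .hd' .tl' (.const _) (.cons .hd' .tl') fun a b => by
    simp [Val.test, Val.size]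

/-- The list of values of a function on a list of indices. -/
abbrev tab {α : Type*} (l : List α) (f : α → Val) : Val := .ofList (l.map f)

theorem tab_cons {α : Type*} (a : α) (l : List α) (f : α → Val) :
    tab (a :: l) f = .cons (f a) (tab l f) := rfl

variable {α : Type*} (l : List α)

@[simp] theorem zipVal_tab (f g : α → Val) :
    zipVal (tab l f) (tab l g) = tab l fun i => .cons (f i) (g i) := by
  rw [zipVal, Val.toList_ofList]
  congr 1
  induction l with
  | nil => rfl
  | cons a l ih => simpa [popMap, tab_cons] using ih

/-- A list with one entry for every position at which two vectors are both true. -/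
def meetVal (a b : Val) : Val :=
  .ofList ((zipVal a b).toList.filter fun p => (if p.hd.test then p.tl else .nil).test)

theorem polyTime_meetVal : PolyTime fun y => meetVal y.hd y.tl :=
  PolyTime.filter (p := fun _ p => if p.hd.test then p.tl else .nil) polyTime_zipVal
    (.ite PolyTime.id.tl.hd PolyTime.id.tl.tl .nil)

theorem len_meetVal (f g : α → Val) :
    (meetVal (tab l f) (tab l g)).len = l.countP fun i => (f i).test && (g i).test := by
  rw [meetVal, zipVal_tab, Val.len, Val.toList_ofList, Val.toList_ofList,
    ← List.countP_eq_length_filter, List.countP_map]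
  congr 1
  funext i
  cases h : (f i).test <;> simp [h]

/-- The sublist of the elements of `b` at the positions where `a` is true. -/
def selectVal (a b : Val) : Val :=
  .ofList ((Val.ofList ((zipVal a b).toList.filter fun p => p.hd.test)).toList.map Val.tl)

theorem polyTime_selectVal : PolyTime fun y => selectVal y.hd y.tl :=
  PolyTime.map (G := fun _ => Val.tl) (PolyTime.filter (p := fun _ p => p.hd) polyTime_zipVal
    PolyTime.id.tl.hd) PolyTime.id.tl.tl

@[simp] theorem selectVal_tab (f g : α → Val) :
    selectVal (tab l f) (tab l g) = tab (l.filter fun i => (f i).test) g := by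
  simp only [selectVal, zipVal_tab, Val.toList_ofList, List.filter_map, List.map_map]
  rfl

/-- The matrix with the rows and columns at the positions where `a` is true. -/
def subMatrixVal (a M : Val) : Val :=
  .ofList ((selectVal a M).toList.map fun r => selectVal a r)

theorem polyTime_subMatrixVal : PolyTime fun y => subMatrixVal y.hd y.tl :=
  PolyTime.map (G := fun x r => selectVal x.hd r) polyTime_selectVal
    (polyTime_selectVal.comp₂ PolyTime.id.hd.hd PolyTime.id.tl)

theorem subMatrixVal_tab (f : α → Val) (g : α → α → Val) :
    subMatrixVal (tab l f) (tab l fun i => tab l (g i)) =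
      tab (l.filter fun i => (f i).test) fun i => tab (l.filter fun i => (f i).test) (g i) := by
  simp [subMatrixVal, Function.comp_def]

/-- Spread the elements of `b` over the positions where `a` is true, with `nil` elsewhere. -/
def expandVal (a b : Val) : Val :=
  .ofList (popMap Val.test (fun x y => if x.test then y else .nil) a.toList b)

theorem polyTime_expandVal : PolyTime fun y => expandVal y.hd y.tl :=
  PolyTime.popMap (c := fun x => x) .hd' .tl' .id (.ite .hd' .tl' .nil) fun a b => by
    split_ifs <;> (try simp only [Val.size]) <;> omega

theorem expandVal_tab (f g : α → Val) :
    expandVal (tab l f) (tab (l.filter fun i => (f i).test) g) =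
      tab l fun i => if (f i).test then g i else .nil := by
  rw [expandVal, Val.toList_ofList]
  congr 1
  induction l with
  | nil => rfl
  | cons a l ih =>
    by_cases ha : (f a).test = true <;>
      simp [popMap, ha, tab_cons, ih]

/-- The elements of a list that count as true. -/
def truesVal (a : Val) : Val := .ofList (a.toList.filter Val.test)

theorem polyTime_truesVal : PolyTime truesVal :=
  PolyTime.filter (p := fun _ a => a) .id PolyTime.id.tl

end WhileLang

/-! ### Treewidth from balanced separators -/

theorem connected_induce_of_parent {N : Type*} {T : SimpleGraph N} (par : N → N) (rank : N → ℕ)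
    (A : Set N) (r : N) (hr : r ∈ A)
    (h : ∀ x ∈ A, x ≠ r → T.Adj x (par x) ∧ par x ∈ A ∧ rank (par x) < rank x) :
    (T.induce A).Connected := by
  have key : ∀ (k : ℕ) (x : A), rank x ≤ k → (T.induce A).Reachable x ⟨r, hr⟩ := by
    intro k
    induction k with
    | zero =>
      rintro ⟨x, hx⟩ hk
      by_cases hxr : x = r
      · subst hxr; exact SimpleGraph.Reachable.refl _
      · have := (h x hx hxr).2.2
        simp only at hk
        omega
    | succ k ih =>
      rintro ⟨x, hx⟩ hk
      by_cases hxr : x = r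
      · subst hxr; exact SimpleGraph.Reachable.refl _
      · obtain ⟨h1, h2, h3⟩ := h x hx hxr
        simp only at hk
        have hadj : (T.induce A).Adj ⟨x, hx⟩ ⟨par x, h2⟩ := h1
        exact hadj.reachable.trans (ih ⟨par x, h2⟩ (by simp only; omega))
  have : Nonempty A := ⟨⟨r, hr⟩⟩
  exact SimpleGraph.Connected.mk fun x y => (key _ x le_rfl).trans (key _ y le_rfl).symm

/-- The graph in which every element other than the root `r` is joined to its parent. -/
def parentGraph {N : Type*} (r : N) (par : N → N) : SimpleGraph N :=
  SimpleGraph.fromRel fun x y => x ≠ r ∧ par x = y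

theorem parentGraph_adj {N : Type*} {r : N} {par : N → N} {x : N} (hx : x ≠ r)
    (hp : par x ≠ x) : (parentGraph r par).Adj x (par x) := by
  simp [parentGraph, hx, hp.symm]

theorem isTree_parentGraph {N : Type*} [Finite N] (r : N) (par : N → N) (rank : N → ℕ)
    (h : ∀ x, x ≠ r → rank (par x) < rank x) : (parentGraph r par).IsTree := by
  classical
  have := Fintype.ofFinite N
  have hne : ∀ x, x ≠ r → par x ≠ x := fun x hx he => by
    have := h x hx
    rw [he] at this
    exact lt_irrefl _ this
  have hconn : (parentGraph r par).Connected := by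
    have := connected_induce_of_parent (T := parentGraph r par) par rank Set.univ r trivial
      fun x _ hx => ⟨parentGraph_adj hx (hne x hx), trivial, h x hx⟩
    exact (SimpleGraph.induceUnivIso _).connected_iff.1 this
  refine SimpleGraph.isTree_iff_connected_and_card.2 ⟨hconn, le_antisymm ?_ ?_⟩
  · have hsub : (parentGraph r par).edgeSet ⊆
        (fun x => s(x, par x)) '' ((Finset.univ.erase r : Finset N) : Set N) := by
      intro z
      induction z with
      | h x y =>
        intro hz
        rw [SimpleGraph.mem_edgeSet, parentGraph, SimpleGraph.fromRel_adj] at hz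
        obtain ⟨-, ⟨h1, h2⟩ | ⟨h1, h2⟩⟩ := hz
        · exact ⟨x, by simp [h1], by simp [h2]⟩
        · exact ⟨y, by simp [h1], by simp [h2, Sym2.eq_swap]⟩
    have h1 := Set.ncard_le_ncard hsub (Set.toFinite _)
    have h2 := (Set.ncard_image_le (f := fun x => s(x, par x))
      (Finset.finite_toSet (Finset.univ.erase r : Finset N)))
    rw [Set.ncard_coe_finset, Finset.card_erase_of_mem (Finset.mem_univ r), Finset.card_univ] at h2
    have h3 : 0 < Fintype.card N := Fintype.card_pos_iff.2 ⟨r⟩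
    rw [Nat.card_coe_set_eq, Nat.card_eq_fintype_card]
    omega
  · exact hconn.card_vert_le_card_edgeSet_add_one

/-- A labelling of the vertices by lists such that the labels of adjacent vertices are comparable
in the suffix order gives a tree decomposition: the tree consists of the suffixes of labels, with
the tail of a list as its parent, and the bag of a list consists of the vertices whose label is a
suffix of it. -/
theorem treewidth_le_of_labelling {V : Type} [Fintype V] (G : SimpleGraph V) (lab : V → List ℕ)
    (w : ℕ) (hadj : ∀ u v, G.Adj u v → lab u <:+ lab v ∨ lab v <:+ lab u)
    (hcard : ∀ l : List ℕ, (Finset.univ.filter fun v => lab v <:+ l).card ≤ w + 1) :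
    treewidth G ≤ w := by
  refine Nat.sInf_le ?_
  let Nodes : Set (List ℕ) := {l | l = [] ∨ ∃ v, l <:+ lab v}
  have hfin : Finite Nodes := by
    have : Nodes ⊆ {[]} ∪ ⋃ v, {l | l ∈ (lab v).tails} := by
      rintro l (rfl | ⟨v, hv⟩)
      · exact Or.inl rfl
      · exact Or.inr (Set.mem_iUnion.2 ⟨v, (List.mem_tails _ _).2 hv⟩)
    exact ((Set.finite_singleton _).union
      (Set.finite_iUnion fun v => List.finite_toSet _)).subset this
  have htail : ∀ l ∈ Nodes, l.tail ∈ Nodes := by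
    rintro l (rfl | ⟨v, hv⟩)
    · exact Or.inl rfl
    · exact Or.inr ⟨v, (List.tail_suffix l).trans hv⟩
  let par : Nodes → Nodes := fun l => ⟨l.1.tail, htail l.1 l.2⟩
  let r : Nodes := ⟨[], Or.inl rfl⟩
  have hrank : ∀ x : Nodes, x ≠ r → (par x).1.length < x.1.length := by
    rintro ⟨l, hl⟩ hx
    have : l ≠ [] := fun h => hx (Subtype.ext h)
    have := List.length_pos_iff.2 this
    simp only [par, List.length_tail]
    omega
  refine ⟨⟨Nodes, hfin, parentGraph r par, isTree_parentGraph r par (fun x => x.1.length) hrank,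
    fun x => Finset.univ.filter fun v => lab v <:+ x.1, fun u => ?_, fun u v huv => ?_⟩,
    fun x => hcard x.1⟩
  · refine connected_induce_of_parent par (fun x => x.1.length) _ ⟨lab u, Or.inr ⟨u, List.suffix_rfl⟩⟩
      (by simp) ?_
    rintro ⟨l, hl⟩ hx hne
    simp only [Finset.mem_filter, Finset.mem_univ, true_and, Set.mem_ofPred_eq] at hx
    have hlu : l ≠ lab u := fun h => hne (Subtype.ext h)
    have hnil : l ≠ [] := by
      rintro rfl
      exact hlu (List.suffix_nil.1 hx).symm
    have hr : (⟨l, hl⟩ : Nodes) ≠ r := fun h => hnil (congrArg Subtype.val h)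
    have hlt := hrank _ hr
    refine ⟨parentGraph_adj hr fun h => ?_, ?_, hlt⟩
    · rw [h] at hlt; exact lt_irrefl _ hlt
    · simp only [Finset.mem_filter, Finset.mem_univ, true_and, Set.mem_ofPred_eq, par]
      obtain ⟨a, m, rfl⟩ := List.exists_cons_of_ne_nil hnil
      rcases List.suffix_cons_iff.1 hx with h | h
      · exact absurd h.symm hlu
      · exact h
  · rcases hadj u v huv with h | h
    · exact ⟨⟨lab v, Or.inr ⟨v, List.suffix_rfl⟩⟩, by simpa using h, by simp⟩
    · exact ⟨⟨lab u, Or.inr ⟨u, List.suffix_rfl⟩⟩, by simp, by simpa using h⟩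

theorem append_singleton_suffix_iff {a b : List ℕ} {x y : ℕ} :
    a ++ [x] <:+ b ++ [y] ↔ x = y ∧ a <:+ b := by
  constructor
  · rintro ⟨t, ht⟩
    rw [← List.append_assoc] at ht
    obtain ⟨h1, h2⟩ := List.append_inj' ht rfl
    exact ⟨by simpa using h2, t, h1⟩
  · rintro ⟨rfl, t, rfl⟩
    exact ⟨t, by simp⟩

/-- If all graphs of a hereditary class have balanced separators of size `s`, then recursive
separation gives a labelling with few vertices along each path to the root: the vertices of the
separator get the empty label, and the labels of the vertices of a component end with a number
for this component. -/
theorem exists_labelling (Q : ∀ {V : Type}, SimpleGraph V → Prop) (s : ℕ)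
    (hQ : ∀ (V : Type) [Fintype V] (G : SimpleGraph V), Q G → ∀ A : Set V, Q (G.induce A))
    (hsep : ∀ (V : Type) [Fintype V] (G : SimpleGraph V), Q G →
      ∃ S : Finset V, IsBalancedSeparator G S ∧ S.card ≤ s) :
    ∀ (d : ℕ) (V : Type) [Fintype V] (G : SimpleGraph V), Q G →
      Fintype.card V * 2 ^ d < 3 ^ d → ∃ lab : V → List ℕ,
        (∀ u v, G.Adj u v → lab u <:+ lab v ∨ lab v <:+ lab u) ∧
        ∀ l : List ℕ, (Finset.univ.filter fun v => lab v <:+ l).card ≤ s * d := by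
  classical
  intro d
  induction d with
  | zero =>
    intro V _ G _ hV
    have h0 : Fintype.card V = 0 := by simpa using hV
    have := Fintype.card_eq_zero_iff.1 h0
    exact ⟨fun _ => [], fun u => isEmptyElim u, fun l => by simp⟩
  | succ d ih =>
    intro V _ G hG hV
    obtain ⟨S, hS, hScard⟩ := hsep V G hG
    let H := G.induce ((S : Set V)ᶜ)
    let part : H.ConnectedComponent → Set V := fun K =>
      {v | ∃ h : v ∈ ((S : Set V)ᶜ), H.connectedComponentMk ⟨v, h⟩ = K}
    have hpart : ∀ K, Fintype.card (part K) * 2 ^ d < 3 ^ d := by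
      intro K
      have h1 : Fintype.card (part K) = K.supp.ncard := by
        have : part K = Subtype.val '' K.supp := by
          ext v
          simp only [part, Set.mem_ofPred_eq, Set.mem_image, SimpleGraph.ConnectedComponent.mem_supp_iff]
          constructor
          · rintro ⟨h, hK⟩; exact ⟨⟨v, h⟩, hK, rfl⟩
          · rintro ⟨⟨u, h⟩, hK, rfl⟩; exact ⟨h, hK⟩
        rw [← Nat.card_eq_fintype_card, Nat.card_coe_set_eq, this,
          Set.ncard_image_of_injective _ Subtype.val_injective]
      have h2 := hS K
      rw [h1]
      rw [pow_succ, pow_succ] at hV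
      have h3 := Nat.mul_le_mul_right (2 ^ d) h2
      nlinarith
    choose labK hadjK hcardK using fun K => ih (part K) (G.induce (part K)) (hQ V G hG _) (hpart K)
    obtain ⟨code, hcode⟩ : ∃ f : H.ConnectedComponent → ℕ, Function.Injective f :=
      Countable.exists_injective_nat _
    let lab : V → List ℕ := fun v => if h : v ∈ S then [] else
      labK (H.connectedComponentMk ⟨v, h⟩) ⟨v, h, rfl⟩ ++ [code (H.connectedComponentMk ⟨v, h⟩)]
    have hlabS : ∀ v ∈ S, lab v = [] := fun v hv => by simp [lab, hv]
    have hlab : ∀ K v (hv : v ∈ part K), lab v = labK K ⟨v, hv⟩ ++ [code K] := by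
      rintro K v ⟨h, rfl⟩
      have h' : v ∉ S := h
      simp [lab, h']
    have hmem : ∀ v, v ∉ S → ∃ K, v ∈ part K := fun v hv => ⟨_, hv, rfl⟩
    refine ⟨lab, fun u v huv => ?_, fun l => ?_⟩
    · by_cases hu : u ∈ S
      · left; rw [hlabS u hu]; exact List.nil_suffix
      by_cases hv : v ∈ S
      · right; rw [hlabS v hv]; exact List.nil_suffix
      have hu' : u ∈ part (H.connectedComponentMk ⟨v, hv⟩) := by
        refine ⟨hu, SimpleGraph.ConnectedComponent.eq.2 (SimpleGraph.Adj.reachable ?_)⟩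
        exact huv
      have hv' : v ∈ part (H.connectedComponentMk ⟨v, hv⟩) := ⟨hv, rfl⟩
      rw [hlab _ u hu', hlab _ v hv', append_singleton_suffix_iff, append_singleton_suffix_iff]
      have := hadjK _ ⟨u, hu'⟩ ⟨v, hv'⟩ huv
      tauto
    · by_cases hl : ∃ K l', l = l' ++ [code K]
      · obtain ⟨K, l', rfl⟩ := hl
        have hsub : (Finset.univ.filter fun v => lab v <:+ l' ++ [code K]) ⊆
            S ∪ (Finset.univ.filter fun v => labK K v <:+ l').image Subtype.val := by
          intro v hv
          simp only [Finset.mem_filter, Finset.mem_univ, true_and] at hv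
          by_cases hvS : v ∈ S
          · exact Finset.mem_union_left _ hvS
          obtain ⟨K', hK'⟩ := hmem v hvS
          rw [hlab K' v hK', append_singleton_suffix_iff] at hv
          obtain ⟨h1, h2⟩ := hv
          obtain rfl := hcode h1
          exact Finset.mem_union_right _ (Finset.mem_image.2 ⟨⟨v, hK'⟩, by simpa using h2, rfl⟩)
        have h1 := (Finset.card_le_card hsub).trans (Finset.card_union_le _ _)
        have h2 := Finset.card_image_le (f := (Subtype.val : part K → V))
          (s := Finset.univ.filter fun v => labK K v <:+ l')
        have h3 := hcardK K l'
        rw [mul_add, mul_one]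
        omega
      · have hsub : (Finset.univ.filter fun v => lab v <:+ l) ⊆ S := by
          intro v hv
          simp only [Finset.mem_filter, Finset.mem_univ, true_and] at hv
          by_contra hvS
          obtain ⟨K, hK⟩ := hmem v hvS
          rw [hlab K v hK] at hv
          obtain ⟨t, ht⟩ := hv
          exact hl ⟨K, t ++ labK K ⟨v, hK⟩, by rw [← ht, List.append_assoc]⟩
        have := Finset.card_le_card hsub
        rw [mul_add, mul_one]
        omega

/-- Separators of size `s r ^ (e - 1)` in the graphs of the class with at most `r ^ e` vertices
and maximum degree at most `2 r ^ 2`, where `e = q + 2`. The two assumptions on separators give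
this for `e = 3` and `e = 4`. -/
def GraphClass.PowerSeparators (D : GraphClass) (q : ℕ) : Prop :=
  ∃ s : ℕ, ∀ r : ℕ, 1 ≤ r → ∀ (V : Type) [Fintype V] (G : SimpleGraph V), D.Mem G →
    Fintype.card V ≤ r ^ (q + 2) → (∀ v, (G.neighborSet v).ncard ≤ 2 * r ^ 2) →
    ∃ S : Finset V, IsBalancedSeparator G S ∧ S.card ≤ s * r ^ (q + 1)

theorem maxDegree_le_of_ncard {V : Type} [Fintype V] (G : SimpleGraph V) [DecidableRel G.Adj] {k : ℕ}
    (h : ∀ v, (G.neighborSet v).ncard ≤ k) : G.maxDegree ≤ k := by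
  refine G.maxDegree_le_of_forall_degree_le k fun v => ?_
  rw [← SimpleGraph.card_neighborSet_eq_degree, ← Nat.card_eq_fintype_card, Nat.card_coe_set_eq]
  exact h v

theorem GraphClass.DegreeSeparators.powerSeparators {D : GraphClass} (h : D.DegreeSeparators) :
    D.PowerSeparators 1 := by
  classical
  obtain ⟨c, hc⟩ := h
  refine ⟨⌈3 * |c|⌉₊, fun r hr V _ G hG _ hdeg => ?_⟩
  obtain ⟨S, hS, hcard⟩ := hc V G hG
  refine ⟨S, hS, ?_⟩
  have h1 : (G.maxDegree : ℝ) ≤ 2 * (r : ℝ) ^ 2 := by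
    exact_mod_cast maxDegree_le_of_ncard G hdeg
  have hr' : (1 : ℝ) ≤ r := by exact_mod_cast hr
  have h2 : (S.card : ℝ) ≤ 3 * |c| * (r : ℝ) ^ 2 :=
    calc (S.card : ℝ) ≤ c * (G.maxDegree + 1) := hcard
      _ ≤ |c| * (G.maxDegree + 1) := mul_le_mul_of_nonneg_right (le_abs_self c) (by positivity)
      _ ≤ |c| * (3 * (r : ℝ) ^ 2) := mul_le_mul_of_nonneg_left (by nlinarith) (abs_nonneg c)
      _ = _ := by ring
  have h3 : 3 * |c| * (r : ℝ) ^ 2 ≤ (⌈3 * |c|⌉₊ : ℝ) * (r : ℝ) ^ 2 :=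
    mul_le_mul_of_nonneg_right (Nat.le_ceil _) (by positivity)
  exact_mod_cast h2.trans h3

theorem GraphClass.SqrtDegreeSeparators.powerSeparators {D : GraphClass}
    (h : D.SqrtDegreeSeparators) : D.PowerSeparators 2 := by
  classical
  obtain ⟨c, hc⟩ := h
  refine ⟨⌈3 * |c|⌉₊, fun r hr V _ G hG hV hdeg => ?_⟩
  obtain ⟨S, hS, hcard⟩ := hc V G hG
  refine ⟨S, hS, ?_⟩
  have h1 : (G.maxDegree : ℝ) ≤ 2 * (r : ℝ) ^ 2 := by
    exact_mod_cast maxDegree_le_of_ncard G hdeg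
  have hV' : (Fintype.card V : ℝ) ≤ (r : ℝ) ^ 4 := by exact_mod_cast hV
  have hr' : (1 : ℝ) ≤ r := by exact_mod_cast hr
  have hr3 : (1 : ℝ) ≤ (r : ℝ) ^ 3 := one_le_pow₀ hr'
  have h0 : Real.sqrt ((Fintype.card V : ℝ) * (G.maxDegree : ℝ)) ≤ 2 * (r : ℝ) ^ 3 := by
    refine Real.sqrt_le_iff.2 ⟨by positivity, ?_⟩
    calc (Fintype.card V : ℝ) * (G.maxDegree : ℝ) ≤ (r : ℝ) ^ 4 * (2 * (r : ℝ) ^ 2) := by gcongr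
      _ ≤ (2 * (r : ℝ) ^ 3) ^ 2 := by
        have : (0 : ℝ) ≤ (r : ℝ) ^ 6 := by positivity
        nlinarith
  have h2 : (S.card : ℝ) ≤ 3 * |c| * (r : ℝ) ^ 3 :=
    calc (S.card : ℝ) ≤ c * (Real.sqrt ((Fintype.card V : ℝ) * (G.maxDegree : ℝ)) + 1) := hcard
      _ ≤ |c| * (Real.sqrt ((Fintype.card V : ℝ) * (G.maxDegree : ℝ)) + 1) :=
        mul_le_mul_of_nonneg_right (le_abs_self c) (by positivity)
      _ ≤ |c| * (3 * (r : ℝ) ^ 3) := mul_le_mul_of_nonneg_left (by linarith) (abs_nonneg c)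
      _ = _ := by ring
  have h3 : 3 * |c| * (r : ℝ) ^ 3 ≤ (⌈3 * |c|⌉₊ : ℝ) * (r : ℝ) ^ 3 :=
    mul_le_mul_of_nonneg_right (Nat.le_ceil _) (by positivity)
  exact_mod_cast h2.trans h3

theorem ncard_neighborSet_induce_le {V : Type} [Finite V] (G : SimpleGraph V) (A : Set V) (v : A) :
    ((G.induce A).neighborSet v).ncard ≤ (G.neighborSet v).ncard := by
  rw [← Set.ncard_image_of_injective _ (Subtype.val_injective : Function.Injective (Subtype.val : A → V))]
  refine Set.ncard_le_ncard ?_ (Set.toFinite _)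
  rintro _ ⟨u, hu, rfl⟩
  exact hu

/-- The treewidth of a graph that has small degrees outside of a set `Z`. -/
theorem treewidth_le_of_powerSeparators {D : GraphClass} (hD : D.Hereditary) {q s r d : ℕ}
    (hsep : ∀ (V : Type) [Fintype V] (G : SimpleGraph V), D.Mem G →
      Fintype.card V ≤ r ^ (q + 2) → (∀ v, (G.neighborSet v).ncard ≤ 2 * r ^ 2) →
      ∃ S : Finset V, IsBalancedSeparator G S ∧ S.card ≤ s)
    {V : Type} [Fintype V] (G : SimpleGraph V) (hG : D.Mem G)
    (hV : Fintype.card V ≤ r ^ (q + 2)) (hd : Fintype.card V * 2 ^ d < 3 ^ d) (Z : Finset V)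
    (hZ : ∀ v, v ∉ Z → (G.neighborSet v).ncard ≤ 2 * r ^ 2) :
    treewidth G ≤ Z.card + s * d := by
  classical
  obtain ⟨lab, hadj, hcard⟩ := exists_labelling
    (fun {W} H => D.Mem H ∧ Finite W ∧ Nat.card W ≤ r ^ (q + 2) ∧
      ∀ v, (H.neighborSet v).ncard ≤ 2 * r ^ 2) s
    (by
      rintro W _ H ⟨h1, _, h2, h3⟩ A
      refine ⟨hD W H h1 A, inferInstance, (Finite.card_subtype_le _).trans h2, fun v => ?_⟩
      exact (ncard_neighborSet_induce_le H A v).trans (h3 v))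
    (by
      rintro W _ H ⟨h1, _, h2, h3⟩
      exact hsep W H h1 (by rwa [← Nat.card_eq_fintype_card]) h3)
    d ((Z : Set V)ᶜ : Set V) (G.induce ((Z : Set V)ᶜ))
    ⟨hD V G hG _, inferInstance, (Finite.card_subtype_le _).trans (by rwa [Nat.card_eq_fintype_card]),
      fun v => (ncard_neighborSet_induce_le G _ v).trans (hZ v.1 v.2)⟩
    (lt_of_le_of_lt (Nat.mul_le_mul_right _ (Fintype.card_subtype_le _)) hd)
  let lab' : V → List ℕ := fun v => if h : v ∈ Z then [] else lab ⟨v, h⟩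
  have h1 : ∀ v ∈ Z, lab' v = [] := fun v hv => by simp [lab', hv]
  have h2 : ∀ v (hv : v ∉ Z), lab' v = lab ⟨v, hv⟩ := fun v hv => by simp [lab', hv]
  refine treewidth_le_of_labelling G lab' _ (fun u v huv => ?_) fun l => ?_
  · by_cases hu : u ∈ Z
    · left; rw [h1 u hu]; exact List.nil_suffix
    by_cases hv : v ∈ Z
    · right; rw [h1 v hv]; exact List.nil_suffix
    rw [h2 u hu, h2 v hv]
    exact hadj ⟨u, hu⟩ ⟨v, hv⟩ huv
  · have hsub : (Finset.univ.filter fun v => lab' v <:+ l) ⊆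
        Z ∪ (Finset.univ.filter fun v => lab v <:+ l).image Subtype.val := by
      intro v hv
      simp only [Finset.mem_filter, Finset.mem_univ, true_and] at hv
      by_cases hvZ : v ∈ Z
      · exact Finset.mem_union_left _ hvZ
      rw [h2 v hvZ] at hv
      exact Finset.mem_union_right _ (Finset.mem_image.2 ⟨⟨v, hvZ⟩, by simpa using hv, rfl⟩)
    have e1 := (Finset.card_le_card hsub).trans (Finset.card_union_le _ _)
    have e2 := Finset.card_image_le (f := (Subtype.val : ((Z : Set V)ᶜ : Set V) → V))
      (s := Finset.univ.filter fun v => lab v <:+ l)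
    have e3 := hcard l
    omega

/-! ### A small certificate for a large induced subgraph -/

/-- A sparse set `A` has few vertices with many neighbours in `A`. -/
theorem card_highDegree_mul_le {V : Type} [Fintype V] [DecidableEq V] (G : SimpleGraph V)
    [DecidableRel G.Adj] (A : Finset V) (r m : ℕ)
    (hm : (G.induce (A : Set V)).edgeSet.ncard ≤ m) :
    (A.filter fun v => r < (A.filter fun u => G.Adj v u).card).card * r ≤ 2 * m := by
  classical
  have h1 := (G.induce (A : Set V)).sum_degrees_eq_twice_card_edges
  have h2 : (G.induce (A : Set V)).edgeFinset.card ≤ m := by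
    rwa [← SimpleGraph.coe_edgeFinset, Set.ncard_coe_finset] at hm
  have h3 : ∀ v : (A : Set V), (G.induce (A : Set V)).degree v =
      (A.filter fun u => G.Adj v u).card := by
    intro v
    rw [← SimpleGraph.card_neighborFinset_eq_degree,
      ← Finset.card_image_of_injective ((G.induce (A : Set V)).neighborFinset v)
        Subtype.val_injective]
    congr 1
    ext u
    simp [and_comm]
  have h4 : ∑ v ∈ A, (A.filter fun u => G.Adj v u).card =
      ∑ v : (A : Set V), (G.induce (A : Set V)).degree v := by
    rw [Finset.sum_congr rfl fun v _ => h3 v]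
    exact (Finset.sum_coe_sort A fun v => (A.filter fun u => G.Adj v u).card).symm
  calc _ ≤ ∑ v ∈ A.filter fun v => r < (A.filter fun u => G.Adj v u).card,
          (A.filter fun u => G.Adj v u).card := by
        rw [← smul_eq_mul]
        exact Finset.card_nsmul_le_sum _ _ _ fun v hv => (Finset.mem_filter.1 hv).2.le
    _ ≤ ∑ v ∈ A, (A.filter fun u => G.Adj v u).card :=
        Finset.sum_le_sum_of_subset (Finset.filter_subset _ _)
    _ ≤ 2 * m := by omega

/-- The vertices that survive the choice of the pivots `P` and the protected vertices `Z`: the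
neighbours of pivots are deleted unless they are protected. -/
def survivors {V : Type} [Fintype V] [DecidableEq V] (G : SimpleGraph V) [DecidableRel G.Adj]
    (P Z : Finset V) : Finset V :=
  Finset.univ.filter fun v => v ∈ Z ∨ ∀ u, G.Adj v u → u ∉ P

theorem subset_survivors {V : Type} [Fintype V] [DecidableEq V] (G : SimpleGraph V)
    [DecidableRel G.Adj] (P Z : Finset V) : Z ⊆ survivors G P Z :=
  fun _ h => Finset.mem_filter.2 ⟨Finset.mem_univ _, Or.inl h⟩

/-- For every sparse set `A` there are few pivots and protected vertices such that all vertices of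
`A` survive and every unprotected vertex of `A` has few surviving neighbours. The protected
vertices are those of large degree in `G[A]`, the pivots, and the neighbours of pivots in `A`;
the pivots are a maximal set of vertices of small degree in `G[A]` which have, on average, at
least `r ^ 2` private neighbours outside of `A`. -/
theorem exists_pivots {V : Type} [Fintype V] [DecidableEq V] (G : SimpleGraph V)
    [DecidableRel G.Adj] (A : Finset V) (c q r : ℕ) (hr : 1 ≤ r)
    (hV : Fintype.card V ≤ r ^ (q + 2))
    (hA : (G.induce (A : Set V)).edgeSet.ncard ≤ c * Fintype.card V) :
    ∃ P Z : Finset V, P ⊆ Z ∧ Z.card ≤ (2 * c + 2) * r ^ (q + 1) ∧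
      ∀ v ∈ A, v ∈ Z ∨ (v ∈ survivors G P Z ∧
        ((survivors G P Z).filter fun u => G.Adj v u).card ≤ r ^ 2 + r) := by
  obtain ⟨X, hX⟩ : ∃ X, X = A.filter fun v => r < (A.filter fun u => G.Adj v u).card := ⟨_, rfl⟩
  have hXc : X.card ≤ 2 * c * r ^ (q + 1) := by
    have h1 := card_highDegree_mul_le G A r _ hA
    rw [← hX] at h1
    have h2 : X.card * r ≤ (2 * c * r ^ (q + 1)) * r :=
      calc X.card * r ≤ 2 * (c * Fintype.card V) := h1
        _ ≤ 2 * (c * r ^ (q + 2)) := by gcongr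
        _ = _ := by ring
    exact Nat.le_of_mul_le_mul_right h2 hr
  -- the deleted vertices
  let W : Finset V → Finset V := fun P =>
    Finset.univ.filter fun v => v ∉ A ∧ ∃ u ∈ P, G.Adj v u
  have hne : ((A \ X).powerset.filter fun P => P.card * r ^ 2 ≤ (W P).card).Nonempty :=
    ⟨∅, by simp⟩
  obtain ⟨P, hP, hmax⟩ := Finset.exists_max_image _ Finset.card hne
  rw [Finset.mem_filter, Finset.mem_powerset] at hP
  obtain ⟨hPA, hPW⟩ := hP
  have hPA' : ∀ v ∈ P, v ∈ A ∧ (A.filter fun u => G.Adj v u).card ≤ r := by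
    intro v hv
    have := hPA hv
    simp only [hX, Finset.mem_sdiff, Finset.mem_filter, not_and, not_lt] at this
    exact ⟨this.1, this.2 this.1⟩
  have hPc : P.card ≤ r ^ q := by
    have h1 : P.card * r ^ 2 ≤ r ^ q * r ^ 2 := by
      rw [← pow_add]
      exact hPW.trans ((Finset.card_le_univ _).trans hV)
    exact Nat.le_of_mul_le_mul_right h1 (by positivity)
  obtain ⟨Z, hZ⟩ : ∃ Z, Z = X ∪ (P ∪ P.biUnion fun v => A.filter fun u => G.Adj v u) := ⟨_, rfl⟩
  have hZA : Z ⊆ A := by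
    rw [hZ]
    refine Finset.union_subset (hX ▸ Finset.filter_subset _ _) (Finset.union_subset
      (fun v hv => (hPA' v hv).1) (Finset.biUnion_subset.2 fun v _ => Finset.filter_subset _ _))
  have hsurv : ∀ v, v ∈ survivors G P Z ↔ v ∉ W P := by
    intro v
    simp only [survivors, W, Finset.mem_filter, Finset.mem_univ, true_and, not_and, not_exists]
    constructor
    · rintro (h | h) hv u hu hvu
      · exact hv (hZA h)
      · exact h u hvu hu
    · intro h
      by_cases hv : v ∈ A
      · by_cases h' : ∃ u ∈ P, G.Adj v u
        · obtain ⟨u, hu, huv⟩ := h'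
          left
          rw [hZ]
          exact Finset.mem_union_right _ (Finset.mem_union_right _ (Finset.mem_biUnion.2
            ⟨u, hu, Finset.mem_filter.2 ⟨hv, huv.symm⟩⟩))
        · right
          intro u hvu hu
          exact h' ⟨u, hu, hvu⟩
      · right
        intro u hvu hu
        exact h hv u hu hvu
  refine ⟨P, Z, ?_, ?_, fun v hv => ?_⟩
  · rw [hZ]
    exact Finset.subset_union_left.trans Finset.subset_union_right
  · have h1 : (P.biUnion fun v => A.filter fun u => G.Adj v u).card ≤ P.card * r :=
      Finset.card_biUnion_le_card_mul _ _ _ fun v hv => (hPA' v hv).2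
    have h2 : Z.card ≤ X.card + (P.card + P.card * r) := by
      rw [hZ]
      refine (Finset.card_union_le _ _).trans (Nat.add_le_add_left ?_ _)
      exact (Finset.card_union_le _ _).trans (Nat.add_le_add_left h1 _)
    have h3 : P.card ≤ r ^ (q + 1) := hPc.trans (Nat.pow_le_pow_right hr (by omega))
    have h4 : P.card * r ≤ r ^ (q + 1) := by
      rw [pow_succ]; exact Nat.mul_le_mul_right _ hPc
    nlinarith
  · by_cases hvZ : v ∈ Z
    · exact Or.inl hvZ
    right
    have hvW : v ∉ W P := by simp [W, hv]
    refine ⟨(hsurv v).2 hvW, ?_⟩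
    by_contra hlt
    rw [not_le] at hlt
    have hvX : v ∉ X := fun h => hvZ (hZ ▸ Finset.mem_union_left _ h)
    have hvP : v ∉ P := fun h => hvZ (hZ ▸ Finset.mem_union_right _ (Finset.mem_union_left _ h))
    have hvr : (A.filter fun u => G.Adj v u).card ≤ r := by
      by_contra h
      exact hvX (hX ▸ Finset.mem_filter.2 ⟨hv, not_le.1 h⟩)
    -- adding `v` to the pivots deletes its surviving neighbours outside of `A`
    have hins : (insert v P).card * r ^ 2 ≤ (W (insert v P)).card := by
      have hsub : W P ∪ ((survivors G P Z).filter fun u => G.Adj v u) \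
          (A.filter fun u => G.Adj v u) ⊆ W (insert v P) := by
        intro u hu
        simp only [W, Finset.mem_union, Finset.mem_sdiff, Finset.mem_filter, Finset.mem_univ,
          true_and] at hu ⊢
        rcases hu with ⟨h1, w, hw, huw⟩ | ⟨⟨_, h1⟩, h2⟩
        · exact ⟨h1, w, Finset.mem_insert_of_mem hw, huw⟩
        · exact ⟨fun h => h2 ⟨h, h1⟩, v, Finset.mem_insert_self _ _, h1.symm⟩
      have hdisj : Disjoint (W P) (((survivors G P Z).filter fun u => G.Adj v u) \
          (A.filter fun u => G.Adj v u)) := by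
        rw [Finset.disjoint_left]
        intro u hu hu'
        exact (hsurv u).1 (Finset.mem_filter.1 (Finset.mem_sdiff.1 hu').1).1 hu
      have h1 := Finset.card_le_card hsub
      rw [Finset.card_union_of_disjoint hdisj] at h1
      have h2 := Finset.le_card_sdiff (A.filter fun u => G.Adj v u)
        ((survivors G P Z).filter fun u => G.Adj v u)
      rw [Finset.card_insert_of_notMem hvP, add_mul, one_mul]
      omega
    have := hmax (insert v P) (Finset.mem_filter.2 ⟨Finset.mem_powerset.2
      (Finset.insert_subset (Finset.mem_sdiff.2 ⟨hv, hvX⟩) hPA), hins⟩)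
    rw [Finset.card_insert_of_notMem hvP] at this
    omega

namespace WhileLang

/-! ### Enumeration of the certificates -/

/-- The mark of a protected vertex that is not a pivot. -/
abbrev Val.mark : Val := .cons .nil .nil

/-- The mark of a pivot; pivots are protected, too. -/
abbrev Val.pivotMark : Val := .cons .nil (.cons .nil .nil)

/-- The one-step extensions of a partial certificate: a pair of a list of marks, where `nil` is the
mark of an ordinary vertex, and the unary number of further vertices that may be protected. -/
def extensions (a : Val) : List Val :=
  .cons (.cons .nil a.hd) a.tl ::
    if a.tl.test then
      [.cons (.cons .mark a.hd) a.tl.tl, .cons (.cons .pivotMark a.hd) a.tl.tl]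
    else []

/-- All extensions of the elements of a list of partial certificates. -/
def extendAll (acc : Val) : Val := .ofList (acc.toList.flatMap extensions)

theorem polyTime_extendAll : PolyTime extendAll := by
  have key : PolyTime fun x => x.toList.foldr (fun a out =>
      .cons (.cons (.cons .nil a.hd) a.tl) (if a.tl.test then
        .cons (.cons (.cons .mark a.hd) a.tl.tl) (.cons (.cons (.cons .pivotMark a.hd) a.tl.tl) out)
        else out)) .nil := by
    refine PolyTime.foldr (F := fun _ a out =>
      .cons (.cons (.cons .nil a.hd) a.tl) (if a.tl.test then
        .cons (.cons (.cons .mark a.hd) a.tl.tl) (.cons (.cons (.cons .pivotMark a.hd) a.tl.tl) out)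
        else out)) .nil .id ?_ ⟨4, fun x a out => ?_⟩
    · have ha : PolyTime fun y => y.tl.hd := PolyTime.id.tl.hd
      have ho : PolyTime fun y => y.tl.tl := PolyTime.id.tl.tl
      exact .cons (.cons (.cons .nil ha.hd) ha.tl) (.ite ha.tl
        (.cons (.cons (.cons (.const _) ha.hd) ha.tl.tl)
          (.cons (.cons (.cons (.const _) ha.hd) ha.tl.tl) ho)) ho)
    · have h0 : 64 * (x.size + a.size + 2) ≤ (x.size + a.size + 2) ^ 4 := by
        have h1 : 4 ≤ x.size + a.size + 2 := by
          have := Val.size_pos x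
          have := Val.size_pos a
          omega
        calc 64 * (x.size + a.size + 2) = 4 ^ 3 * (x.size + a.size + 2) := by norm_num
          _ ≤ (x.size + a.size + 2) ^ 3 * (x.size + a.size + 2) :=
            Nat.mul_le_mul_right _ (Nat.pow_le_pow_left h1 3)
          _ = _ := by ring
      refine le_trans ?_ (Nat.add_le_add_left h0 _)
      have h1 := Val.size_hd_le a
      have h2 := Val.size_tl_le a
      have h3 := Val.size_tl_le a.tl
      split_ifs <;> simp only [Val.size] <;> omega
  refine cast (congrArg PolyTime (funext fun x => ?_)) key
  unfold extendAll
  induction x.toList with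
  | nil => rfl
  | cons a l ih =>
    rw [List.foldr_cons, ih]
    by_cases h : a.tl.test = true <;> simp [extensions, h, Val.ofList]

/-- All certificates for the list `x` of the rows of a matrix, with at most `len K` protected
vertices. -/
def certificates (K x : Val) : Val :=
  x.toList.foldl (fun acc _ => extendAll acc) (.cons (.cons .nil K) .nil)

/-- What holds for the partial certificates while `i` rows remain: a bound `6 (n - i) + s + 2` on
their sizes, and a bound on the number of certificates that they have, where a partial certificate
with `k` further protected vertices has at most `(2 i + 1) ^ k` of them. -/
def CertificateInv (n K s : ℕ) (i : ℕ) (acc : Val) : Prop :=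
  (∀ a ∈ acc.toList, a.size + 6 * i ≤ 6 * n + s + 2) ∧
    (acc.toList.map fun a => (2 * i + 1) ^ a.tl.len).sum ≤ (2 * n + 1) ^ K

theorem CertificateInv.step {n K s i : ℕ} {acc : Val} (h : CertificateInv n K s (i + 1) acc) :
    CertificateInv n K s i (extendAll acc) := by
  obtain ⟨h1, h2⟩ := h
  refine ⟨fun b hb => ?_, le_trans ?_ h2⟩
  · simp only [extendAll, Val.toList_ofList, List.mem_flatMap] at hb
    obtain ⟨a, ha, hb⟩ := hb
    have h3 := h1 a ha
    have h4 : a.hd.size + a.tl.size ≤ a.size + 1 := by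
      rcases a with _ | ⟨m, k⟩
      · exact le_rfl
      · simp only [Val.size, Val.hd_cons, Val.tl_cons]; omega
    have h5 : a.tl.test = true → a.tl.tl.size + 2 ≤ a.tl.size := by
      rcases a.tl with _ | ⟨m, k⟩
      · simp
      · have := Val.size_pos m
        simp only [Val.size, Val.tl_cons]; omega
    simp only [extensions, List.mem_cons] at hb
    rcases hb with rfl | hb
    · simp only [Val.size]; omega
    · split_ifs at hb with ht
      · have h6 := h5 ht
        simp only [List.mem_cons, List.not_mem_nil, or_false] at hb
        rcases hb with rfl | rfl <;> simp only [Val.size] <;> omega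
      · simp at hb
  · simp only [extendAll, Val.toList_ofList]
    induction acc.toList with
    | nil => simp
    | cons a l ih =>
      simp only [List.flatMap_cons, List.map_append, List.sum_append, List.map_cons, List.sum_cons]
      refine Nat.add_le_add ?_ ih
      simp only [extensions, List.map_cons, List.sum_cons, Val.tl_cons, test_eq_len]
      rcases hk : a.tl.len with _ | k
      · simp
      · simp only [Nat.zero_lt_succ, decide_true, if_true, List.map_cons, List.sum_cons,
          List.map_nil, List.sum_nil, Val.tl_cons]
        rw [len_tl, hk, Nat.add_sub_cancel]
        have h5 : (2 * i + 1) ^ k ≤ (2 * (i + 1) + 1) ^ k := Nat.pow_le_pow_left (by omega) k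
        calc _ = (2 * i + 1) ^ k * (2 * (i + 1) + 1) := by ring
          _ ≤ (2 * (i + 1) + 1) ^ k * (2 * (i + 1) + 1) := Nat.mul_le_mul_right _ h5
          _ = _ := by ring

theorem CertificateInv.size_le {n K s i : ℕ} {acc : Val} (h : CertificateInv n K s i acc) :
    acc.toList.length ≤ (2 * n + 1) ^ K ∧
      acc.size ≤ (2 * n + 1) ^ K * (6 * n + s + 3) + 1 := by
  obtain ⟨h1, h2⟩ := h
  have h3 : acc.toList.length ≤ (2 * n + 1) ^ K := by
    refine le_trans ?_ h2
    have := List.card_nsmul_le_sum (acc.toList.map fun a => (2 * i + 1) ^ a.tl.len) 1 (by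
      intro x hx
      obtain ⟨a, -, rfl⟩ := List.mem_map.1 hx
      exact Nat.one_le_pow _ _ (by omega))
    simpa using this
  refine ⟨h3, ?_⟩
  have h4 : acc.size = (acc.toList.map fun a => a.size + 1).sum + 1 := by
    conv_lhs => rw [← Val.ofList_toList acc]
    exact Val.size_ofList _
  have h5 := List.sum_le_card_nsmul (acc.toList.map fun a => a.size + 1) (6 * n + s + 3) (by
    intro x hx
    obtain ⟨a, ha, rfl⟩ := List.mem_map.1 hx
    have := h1 a ha
    omega)
  rw [List.length_map, smul_eq_mul] at h5
  rw [h4]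
  exact Nat.add_le_add_right (h5.trans (Nat.mul_le_mul_right _ h3)) 1

theorem certificateInv_init (n : ℕ) (K : Val) :
    CertificateInv n K.len K.size n (.cons (.cons .nil K) .nil) := by
  constructor
  · intro a ha
    simp only [Val.toList, List.mem_singleton] at ha
    subst ha
    simp only [Val.size]; omega
  · simp [Val.toList]

theorem certificateInv_certificates (K x : Val) :
    CertificateInv x.len K.len K.size 0 (certificates K x) := by
  have key : ∀ (l : List Val) (acc : Val), CertificateInv x.len K.len K.size l.length acc →
      CertificateInv x.len K.len K.size 0 (l.foldl (fun acc _ => extendAll acc) acc) := by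
    intro l
    induction l with
    | nil => intro acc h; exact h
    | cons a l ih => intro acc h; exact ih _ h.step
  exact key _ _ (certificateInv_init _ _)

/-- A bound for the number of certificates. -/
def certificateCount (K x : Val) : ℕ := (2 * x.len + 1) ^ K.len

theorem certificateCount_pos (K x : Val) : 1 ≤ certificateCount K x :=
  Nat.one_le_pow _ _ (by omega)

theorem runsIn_certificates {κ : Val → Val} (hκ : PolyTime κ) :
    ∃ k : ℕ, RunsIn (fun _ => True) (fun x => certificates (κ x) x)
      (fun x => ((x.size + 2) * certificateCount (κ x) x) ^ k) := by
  obtain ⟨-, TE, ⟨m, hm⟩, hE⟩ := polyTime_extendAll.comp PolyTime.id.tl.tl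
  obtain ⟨hg1, Tg, hg2, hg3⟩ := PolyTime.cons (PolyTime.cons .nil hκ) .nil
  let B : Val → ℕ := fun x => ((2 * x.size + 9 * x.size + (κ x).size + 10) ^ m) *
    certificateCount (κ x) x ^ m
  have hrun := RunsIn.foldl (F := fun _ _ acc => extendAll acc) (B := B) hg3 (RunsIn.id _) hE
    (fun x l acc => CertificateInv x.len (κ x).len (κ x).size l.length acc)
    (fun x _ => certificateInv_init _ _) (by
      intro x _ a l acc hl hI
      refine ⟨trivial, (hm _).trans ?_, hI.step⟩
      have h1 := hI.size_le.2
      have h2 := Val.size_lt_of_mem (hl.subset List.mem_cons_self)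
      have h3 : x.len < x.size := Val.length_toList_lt x
      have h4 := certificateCount_pos (κ x) x
      simp only [B]
      rw [← mul_pow]
      refine Nat.pow_le_pow_left ?_ m
      change acc.size ≤ certificateCount (κ x) x * _ + 1 at h1
      simp only [Val.size]
      calc _ ≤ 2 * x.size + 5 + certificateCount (κ x) x * (6 * x.len + (κ x).size + 3) := by omega
        _ ≤ certificateCount (κ x) x * (2 * x.size + 5) +
            certificateCount (κ x) x * (6 * x.len + (κ x).size + 3) := by
          exact Nat.add_le_add_right (Nat.le_mul_of_pos_left _ h4) _
        _ = certificateCount (κ x) x * (2 * x.size + 6 * x.len + (κ x).size + 8) := by ring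
        _ ≤ certificateCount (κ x) x * (2 * x.size + 9 * x.size + (κ x).size + 10) :=
          Nat.mul_le_mul_left _ (by omega)
        _ = _ := by ring)
  have hlen : PolyBounded fun x => x.toList.length :=
    PolyBounded.size.mono fun x => (Val.length_toList_lt x).le
  have hp : PolyBounded fun x => Tg x + 1 + x.toList.length *
      ((2 * x.size + 9 * x.size + (κ x).size + 10) ^ m + 20) + 40 :=
    ((hg2.add (.const 1)).add (hlen.mul (((((((PolyBounded.const 2).mul .size).add
      ((PolyBounded.const 9).mul .size)).add hκ.1).add (.const 10)).pow m).add (.const 20)))).add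
        (.const 40)
  obtain ⟨k, hk⟩ := hp
  refine ⟨k + m, hrun.mono (fun _ h => h) fun x _ => ?_⟩
  have h4 := certificateCount_pos (κ x) x
  have h5 : 1 ≤ certificateCount (κ x) x ^ m := Nat.one_le_pow _ _ h4
  have hk' := hk x
  dsimp only [B] at hk' ⊢
  generalize certificateCount (κ x) x = c at *
  generalize (2 * x.size + 9 * x.size + (κ x).size + 10) ^ m = b at *
  calc Tg x + 1 + x.toList.length * (b * c ^ m + 20) + 40
      ≤ (Tg x + 1 + x.toList.length * (b + 20) + 40) * c ^ m := by
        have : x.toList.length * 20 ≤ x.toList.length * 20 * c ^ m := Nat.le_mul_of_pos_right _ h5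
        have : Tg x + 41 ≤ (Tg x + 41) * c ^ m := Nat.le_mul_of_pos_right _ h5
        nlinarith
    _ ≤ (x.size + 2) ^ k * c ^ m := Nat.mul_le_mul_right _ hk'
    _ ≤ (x.size + 2) ^ (k + m) * c ^ (k + m) :=
        Nat.mul_le_mul (Nat.pow_le_pow_right (by omega) (by omega))
          (Nat.pow_le_pow_right h4 (by omega))
    _ = _ := (mul_pow _ _ _).symm

/-- Certificates have one mark per row, and respect the bound on the number of protected
vertices. -/
theorem certificates_sound (K x : Val) : ∀ a ∈ (certificates K x).toList,
    a.hd.len = x.len ∧ a.hd.toList.countP Val.test ≤ K.len := by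
  have key : ∀ (l : List Val) (acc : Val) (j : ℕ),
      (∀ a ∈ acc.toList, a.hd.len = j ∧ a.hd.toList.countP Val.test + a.tl.len ≤ K.len) →
      ∀ a ∈ (l.foldl (fun acc _ => extendAll acc) acc).toList,
        a.hd.len = j + l.length ∧ a.hd.toList.countP Val.test + a.tl.len ≤ K.len := by
    intro l
    induction l with
    | nil => intro acc j h; exact h
    | cons b l ih =>
      intro acc j h a ha
      have := ih (extendAll acc) (j + 1) (by
        intro c hc
        simp only [extendAll, Val.toList_ofList, List.mem_flatMap, extensions, List.mem_cons] at hc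
        obtain ⟨a, ha, hc⟩ := hc
        obtain ⟨h1, h2⟩ := h a ha
        rcases hc with rfl | hc
        · simp only [Val.len, Val.hd_cons, Val.tl_cons, Val.toList, List.length_cons,
            List.countP_cons] at *
          simpa using ⟨h1, h2⟩
        · split_ifs at hc with ht
          · have h3 := len_tl a.tl
            rw [test_eq_len, decide_eq_true_eq] at ht
            simp only [List.mem_cons, List.not_mem_nil, or_false] at hc
            rcases hc with rfl | rfl <;>
            · simp only [Val.len, Val.hd_cons, Val.tl_cons, Val.toList, List.length_cons,
                List.countP_cons, Val.test, if_true] at *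
              omega
          · simp at hc) a ha
      rw [List.length_cons]
      omega
  intro a ha
  have := key x.toList (.cons (.cons .nil K) .nil) 0 (by
    intro a ha
    simp only [Val.toList, List.mem_singleton] at ha
    subst ha
    simp [Val.len, Val.toList]) a ha
  unfold Val.len at *
  omega

/-- All lists of marks that respect the bound occur. -/
theorem certificates_complete (K x : Val) (t : List Val)
    (ht : ∀ a ∈ t, a = .nil ∨ a = .mark ∨ a = .pivotMark) (hlen : t.length = x.len)
    (hK : t.countP Val.test ≤ K.len) : ∃ a ∈ (certificates K x).toList, a.hd = .ofList t := by
  have key : ∀ (l : List Val) (acc : Val) (t u : List Val),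
      (∀ a ∈ t, a = .nil ∨ a = .mark ∨ a = .pivotMark) → t.length = l.length →
      (∃ a ∈ acc.toList, a.hd = .ofList u ∧ t.countP Val.test ≤ a.tl.len) →
      ∃ a ∈ (l.foldl (fun acc _ => extendAll acc) acc).toList, a.hd = .ofList (t.reverse ++ u) := by
    intro l
    induction l with
    | nil =>
      intro acc t u _ hl ⟨a, ha, hu, _⟩
      obtain rfl : t = [] := List.length_eq_zero_iff.1 hl
      exact ⟨a, ha, hu⟩
    | cons b l ih =>
      rintro acc (_ | ⟨c, t⟩) u ht hl ⟨a, ha, hu, hc⟩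
      · simp at hl
      have := ih (extendAll acc) t (c :: u) (fun a ha => ht a (List.mem_cons_of_mem _ ha))
        (by simpa using hl) (by
          simp only [extendAll, Val.toList_ofList, List.mem_flatMap, extensions, List.mem_cons]
          rcases ht c List.mem_cons_self with rfl | hcm
          · refine ⟨_, ⟨a, ha, Or.inl rfl⟩, ?_, ?_⟩
            · rw [Val.hd_cons, hu]; rfl
            · simpa using hc
          · have hct : c.test = true := by rcases hcm with rfl | rfl <;> rfl
            rw [List.countP_cons, if_pos hct] at hc
            have h1 : a.tl.test = true := by rw [test_eq_len, decide_eq_true_eq]; omega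
            refine ⟨.cons (.cons c a.hd) a.tl.tl, ⟨a, ha, Or.inr ?_⟩, ?_, ?_⟩
            · rw [if_pos h1]
              rcases hcm with rfl | rfl <;> simp
            · rw [Val.hd_cons, hu]; rfl
            · rw [Val.tl_cons, len_tl]; omega)
      simpa using this
  have := key x.toList (.cons (.cons .nil K) .nil) t.reverse [] (by simpa using ht)
    (by simpa using hlen) ⟨.cons .nil K, by simp [Val.toList], rfl, by simpa using hK⟩
  simpa [certificates] using this

end WhileLang

namespace WhileLang

/-! ### The branching algorithm and its correctness -/

theorem tab_finRange {n : ℕ} (f : Fin n → Val) :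
    tab (List.finRange n) f = .ofList (List.ofFn f) := by
  rw [List.ofFn_eq_map]

@[simp] theorem test_encodeBool (b : Bool) : (encodeBool b).test = b := by
  cases b <;> rfl

theorem encodeSet_eq {n : ℕ} (A : Finset (Fin n)) :
    encodeSet A = tab (List.finRange n) fun i => encodeBool (decide (i ∈ A)) := by
  rw [encodeSet, encodeList_eq, List.ofFn_eq_map, List.map_map]
  rfl

theorem encodeGraph_eq {n : ℕ} (G : SimpleGraph (Fin n)) [DecidableRel G.Adj] :
    encodeGraph G = tab (List.finRange n) fun i => tab (List.finRange n) fun j =>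
      encodeBool (decide (G.Adj i j)) := by
  rw [encodeGraph, encodeList_eq, List.ofFn_eq_map, List.map_map]
  congr 2
  funext i
  rw [Function.comp_apply, encodeList_eq, List.ofFn_eq_map, List.map_map]
  congr 2
  funext j
  simp only [Function.comp_apply]
  congr

@[simp] theorem len_encodeGraph {n : ℕ} (G : SimpleGraph (Fin n)) : (encodeGraph G).len = n := by
  simp [encodeGraph, encodeList_eq, Val.len]

theorem countP_finRange {n : ℕ} (p : Fin n → Bool) :
    (List.finRange n).countP p = (Finset.univ.filter fun i => p i = true).card := by
  rw [List.countP_eq_length_filter, ← List.toFinset_card_of_nodup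
    ((List.nodup_finRange n).filter _)]
  congr 1
  ext i
  simp

/-- The unary numeral `r ^ 2 + r`, where `r` is about the `(q + 2)`-th root of the number of
vertices: the bound for the degrees of the surviving vertices that are kept. -/
def degreeBoundVal (q : ℕ) (M : Val) : Val :=
  addLen (powLen (rootLen (q + 2) M) 2) (rootLen (q + 2) M)

theorem polyTime_degreeBoundVal (q : ℕ) : PolyTime (degreeBoundVal q) :=
  polyTime_addLen.comp₂ (polyTime_powLen (polyTime_rootLen _) 2) (polyTime_rootLen _)

/-- The bound for the number of protected vertices, in unary. -/
def budgetVal (q c : ℕ) (M : Val) : Val :=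
  mulLen (.ofList (List.replicate (2 * c + 2) .nil)) (powLen (rootLen (q + 2) M) (q + 1))

theorem polyTime_budgetVal (q c : ℕ) : PolyTime (budgetVal q c) :=
  polyTime_mulLen.comp₂ (.const _) (polyTime_powLen (polyTime_rootLen _) _)

theorem len_budgetVal (q c : ℕ) (M : Val) :
    (budgetVal q c M).len = (2 * c + 2) * (rootLen (q + 2) M).len ^ (q + 1) := by
  rw [budgetVal, len_mulLen, len_powLen]
  simp [Val.len]

/-- The characteristic vector of the survivors, for an adjacency matrix and a list of marks. -/
def survivorsVal (M t : Val) : Val :=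
  .ofList ((zipVal M t).toList.map fun p => if p.tl.test then .one else
    if (meetVal p.hd (.ofList (t.toList.map Val.tl))).test then .nil else .one)

theorem polyTime_survivorsVal : PolyTime fun y => survivorsVal y.hd y.tl :=
  PolyTime.map (G := fun x p => if p.tl.test then .one else
    if (meetVal p.hd (.ofList (x.tl.toList.map Val.tl))).test then .nil else .one) polyTime_zipVal
    (.ite PolyTime.id.tl.tl (.const _) (.ite (polyTime_meetVal.comp₂ PolyTime.id.tl.hd
      (PolyTime.map (G := fun _ => Val.tl) PolyTime.id.hd.tl PolyTime.id.tl.tl)) .nil (.const _)))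

/-- The characteristic vector of the vertices that are kept: the protected ones and the survivors
of small degree. -/
def keptVal (q : ℕ) (M t : Val) : Val :=
  .ofList ((zipVal (zipVal M t) (survivorsVal M t)).toList.map fun p =>
    if p.hd.tl.test then .one else if p.tl.test then
      if (dropLen (degreeBoundVal q M) (meetVal p.hd.hd (survivorsVal M t))).test then .nil else .one
    else .nil)

theorem polyTime_keptVal (q : ℕ) : PolyTime fun y => keptVal q y.hd y.tl :=
  PolyTime.map (G := fun x p =>
    if p.hd.tl.test then .one else if p.tl.test then
      if (dropLen (degreeBoundVal q x.hd) (meetVal p.hd.hd (survivorsVal x.hd x.tl))).test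
        then .nil else .one
    else .nil)
    (polyTime_zipVal.comp₂ polyTime_zipVal polyTime_survivorsVal)
    (.ite PolyTime.id.tl.hd.tl (.const _) (.ite PolyTime.id.tl.tl
      (.ite (polyTime_dropLen.comp₂ ((polyTime_degreeBoundVal q).comp PolyTime.id.hd.hd)
        (polyTime_meetVal.comp₂ PolyTime.id.tl.hd.hd (polyTime_survivorsVal.comp PolyTime.id.hd)))
        .nil (.const _)) .nil))

end WhileLang

/-- The vertices that are kept for the pivots `P` and the protected vertices `Z`: the latter and
the survivors with at most `k` surviving neighbours. -/
def keptVertices {V : Type} [Fintype V] [DecidableEq V] (G : SimpleGraph V) [DecidableRel G.Adj]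
    (P Z : Finset V) (k : ℕ) : Finset V :=
  Finset.univ.filter fun v => v ∈ Z ∨
    (v ∈ survivors G P Z ∧ ((survivors G P Z).filter fun u => G.Adj v u).card ≤ k)

namespace WhileLang

/-- The pivots of a list of marks. -/
def pivots {n : ℕ} (t : Fin n → Val) : Finset (Fin n) :=
  Finset.univ.filter fun i => (t i).tl.test = true

/-- The protected vertices of a list of marks. -/
def protectedVertices {n : ℕ} (t : Fin n → Val) : Finset (Fin n) :=
  Finset.univ.filter fun i => (t i).test = true

theorem survivorsVal_eq {n : ℕ} (G : SimpleGraph (Fin n)) [DecidableRel G.Adj] (t : Fin n → Val) :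
    survivorsVal (encodeGraph G) (tab (List.finRange n) t) =
      encodeSet (survivors G (pivots t) (protectedVertices t)) := by
  rw [survivorsVal, encodeGraph_eq, zipVal_tab, encodeSet_eq, Val.toList_ofList, Val.toList_ofList,
    List.map_map, List.map_map]
  congr 2
  funext i
  change (if (t i).test then Val.one else if (meetVal _ (tab _ _)).test then .nil else .one) = _
  simp only [test_eq_len (meetVal _ _), Val.hd_cons, len_meetVal, countP_finRange]
  have h1 : i ∈ survivors G (pivots t) (protectedVertices t) ↔
      (t i).test = true ∨ ¬ 0 < (Finset.univ.filter fun j =>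
        ((encodeBool (decide (G.Adj i j))).test && ((Val.tl ∘ t) j).test) = true).card := by
    simp only [survivors, pivots, protectedVertices, Finset.mem_filter, Finset.mem_univ, true_and,
      Finset.card_pos, Finset.not_nonempty_iff_eq_empty, Finset.filter_eq_empty_iff,
      test_encodeBool, Bool.and_eq_true, decide_eq_true_eq, not_and, forall_const,
      Function.comp_apply]
  by_cases h2 : (t i).test = true
  · rw [if_pos h2, decide_eq_true (h1.2 (Or.inl h2))]
    rfl
  · rw [if_neg h2]
    split_ifs with h3
    · rw [decide_eq_true_eq] at h3
      rw [decide_eq_false fun h => (h1.1 h).elim h2 fun h => h h3]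
      rfl
    · rw [decide_eq_true_eq] at h3
      rw [decide_eq_true (h1.2 (Or.inr h3))]
      rfl

theorem keptVal_eq (q : ℕ) {n : ℕ} (G : SimpleGraph (Fin n)) [DecidableRel G.Adj]
    (t : Fin n → Val) :
    keptVal q (encodeGraph G) (tab (List.finRange n) t) =
      encodeSet (keptVertices G (pivots t) (protectedVertices t)
        ((rootLen (q + 2) (encodeGraph G)).len ^ 2 + (rootLen (q + 2) (encodeGraph G)).len)) := by
  have hk : (degreeBoundVal q (encodeGraph G)).len =
      (rootLen (q + 2) (encodeGraph G)).len ^ 2 + (rootLen (q + 2) (encodeGraph G)).len := by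
    rw [degreeBoundVal, len_addLen, len_powLen]
  rw [keptVal, survivorsVal_eq, ← hk]
  generalize degreeBoundVal q (encodeGraph G) = k
  rw [encodeGraph_eq, zipVal_tab, encodeSet_eq (survivors _ _ _), zipVal_tab, encodeSet_eq,
    Val.toList_ofList, List.map_map]
  congr 2
  funext i
  change (if (t i).test then Val.one else if (encodeBool (decide (i ∈ survivors G (pivots t)
    (protectedVertices t)))).test then if (dropLen k (meetVal (tab _ _) _)).test then .nil else .one
    else .nil) = _
  simp only [test_dropLen, len_meetVal, countP_finRange]
  have h1 : (Finset.univ.filter fun j => ((encodeBool (decide (G.Adj i j))).test &&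
      (encodeBool (decide (j ∈ survivors G (pivots t) (protectedVertices t)))).test) = true) =
      (survivors G (pivots t) (protectedVertices t)).filter fun u => G.Adj i u := by
    ext j
    simp [and_comm]
  rw [h1]
  simp only [keptVertices, Finset.mem_filter, Finset.mem_univ, true_and, decide_eq_true_eq]
  have h2 : i ∈ protectedVertices t ↔ (t i).test = true := by simp [protectedVertices]
  simp only [h2]
  by_cases h3 : (t i).test = true
  · simp [h3, encodeBool]
  · by_cases h4 : i ∈ survivors G (pivots t) (protectedVertices t)
    · by_cases h5 : k.len <
        ((survivors G (pivots t) (protectedVertices t)).filter fun u => G.Adj i u).card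
      · simp [h3, h4, h5, encodeBool, not_le.2 h5]
      · simp [h3, h4, h5, encodeBool, not_lt.1 h5]
    · simp [h3, h4, encodeBool]

/-- An answer for an induced subgraph, as an answer for the graph. -/
def liftVal (m ans : Val) : Val :=
  if ans.test then .cons .nil (expandVal m ans.tl) else .nil

theorem polyTime_liftVal : PolyTime fun y => liftVal y.hd y.tl :=
  .ite .tl' (.cons .nil (polyTime_expandVal.comp₂ .hd' PolyTime.id.tl.tl)) .nil

/-- The answer with more vertices; any answer is better than the report that there is none. -/
def betterVal (best cand : Val) : Val :=
  if cand.test then if best.test then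
    if (dropLen (truesVal best.tl) (truesVal cand.tl)).test then cand else best
  else cand else best

theorem polyTime_betterVal : PolyTime fun y => betterVal y.hd y.tl :=
  .ite .tl' (.ite .hd' (.ite (polyTime_dropLen.comp₂ (polyTime_truesVal.comp PolyTime.id.hd.tl)
    (polyTime_truesVal.comp PolyTime.id.tl.tl)) .tl' .hd') .tl') .hd'

theorem len_truesVal_encodeSet {n : ℕ} (A : Finset (Fin n)) :
    (truesVal (encodeSet A)).len = A.card := by
  rw [encodeSet_eq, truesVal, Val.len, Val.toList_ofList, Val.toList_ofList,
    ← List.countP_eq_length_filter, List.countP_map, countP_finRange]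
  congr 1
  ext i
  simp

/-- The larger one of two answers. -/
def better {n : ℕ} : Option (Finset (Fin n)) → Option (Finset (Fin n)) → Option (Finset (Fin n))
  | o, none => o
  | none, some B => some B
  | some A, some B => if A.card < B.card then some B else some A

theorem betterVal_encodeAnswer {n : ℕ} (o o' : Option (Finset (Fin n))) :
    betterVal (encodeAnswer o) (encodeAnswer o') = encodeAnswer (better o o') := by
  rcases o' with _ | B
  · cases o <;> simp [betterVal, encodeAnswer, better]
  · rcases o with _ | A
    · simp [betterVal, encodeAnswer, better]
    · simp only [betterVal, encodeAnswer, better, Val.tl_cons, test_dropLen,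
        len_truesVal_encodeSet, Val.test_cons, decide_eq_true_eq, if_true]
      split_ifs <;> rfl

theorem tab_get {α : Type*} (l : List α) (f : α → Val) :
    tab l f = tab (List.finRange l.length) fun i => f (l.get i) := by
  conv_lhs => rw [← List.map_get_finRange l]
  rw [tab, List.map_map]
  rfl

/-- The submatrix of the adjacency matrix for a set of vertices encodes a graph that is isomorphic
to the induced subgraph. -/
theorem exists_embedding {n : ℕ} (G : SimpleGraph (Fin n)) (R : Finset (Fin n)) :
    ∃ (m : ℕ) (e : Fin m ↪ Fin n), (∀ v, v ∈ R ↔ ∃ i, e i = v) ∧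
      subMatrixVal (encodeSet R) (encodeGraph G) = encodeGraph (G.comap e) ∧
      ∀ ans : Option (Finset (Fin m)), liftVal (encodeSet R) (encodeAnswer ans) =
        encodeAnswer (ans.map (Finset.map e)) := by
  classical
  obtain ⟨l, hl⟩ : ∃ l, l = (List.finRange n).filter fun i =>
    (encodeBool (decide (i ∈ R))).test := ⟨_, rfl⟩
  have hnd : l.Nodup := hl ▸ (List.nodup_finRange n).filter _
  have hmem : ∀ v, v ∈ l ↔ v ∈ R := fun v => by simp [hl]
  let e : Fin l.length ↪ Fin n := ⟨l.get, List.nodup_iff_injective_get.1 hnd⟩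
  refine ⟨l.length, e, fun v => ?_, ?_, fun ans => ?_⟩
  · rw [← hmem, List.mem_iff_get]
    rfl
  · rw [encodeSet_eq, encodeGraph_eq, subMatrixVal_tab, ← hl, encodeGraph_eq, tab_get]
    congr 2
    funext i
    rw [tab_get]
    rfl
  · rcases ans with _ | A
    · rfl
    · have h1 : encodeSet A = tab l fun v => encodeBool (decide (v ∈ A.map e)) := by
        rw [encodeSet_eq, tab_get l]
        congr 2
        funext i
        congr 1
        refine decide_eq_decide.2 ?_
        exact (Finset.mem_map' e).symm
      have h2 : encodeAnswer (some A) = .cons .nil (encodeSet A) := rfl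
      have h3 : ∀ g : Fin n → Val, expandVal (encodeSet R) (tab l g) =
          tab (List.finRange n) fun i => if (encodeBool (decide (i ∈ R))).test then g i else .nil := by
        intro g
        rw [hl, encodeSet_eq R, expandVal_tab]
      rw [h2, liftVal, Val.tl_cons, h1, h3]
      simp only [Val.test_cons, if_true, Option.map_some, encodeAnswer, encodeSet_eq]
      congr 3
      funext v
      by_cases hv : v ∈ R
      · simp [hv]
      · have : v ∉ A.map e := by
          intro h
          obtain ⟨i, -, rfl⟩ := Finset.mem_map.1 h
          exact hv ((hmem _).1 (List.get_mem l i))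
        rw [decide_eq_false this, decide_eq_false hv]
        rfl

end WhileLang

/-- The subgraphs induced by corresponding sets of vertices are isomorphic. -/
theorem GraphClass.mem_induce_comap_iff (C : GraphClass) {m n : ℕ} (e : Fin m ↪ Fin n)
    (G : SimpleGraph (Fin n)) (A : Finset (Fin m)) :
    C.Mem ((G.comap e).induce (A : Set (Fin m))) ↔
      C.Mem (G.induce ((A.map e : Finset (Fin n)) : Set (Fin n))) := by
  have φ : (G.comap e).induce (A : Set (Fin m)) ≃g
      G.induce ((A.map e : Finset (Fin n)) : Set (Fin n)) :=
    { toEquiv := (Equiv.Set.image e (A : Set (Fin m)) e.injective).trans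
        (Equiv.setCongr (by simp))
      map_rel_iff' := by
        intro a b
        rfl }
  exact ⟨C.iso ⟨φ⟩, C.iso ⟨φ.symm⟩⟩

theorem GraphClass.Hereditary.mem_comap {D : GraphClass} (hD : D.Hereditary) {m n : ℕ}
    (e : Fin m ↪ Fin n) {G : SimpleGraph (Fin n)} (hG : D.Mem G) : D.Mem (G.comap e) := by
  have φ : G.induce (Set.range e) ≃g G.comap e :=
    { toEquiv := (Equiv.ofInjective e e.injective).symm
      map_rel_iff' := by
        rintro ⟨_, a, rfl⟩ ⟨_, b, rfl⟩
        simp [Equiv.ofInjective_symm_apply] }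
  exact D.iso ⟨φ⟩ (hD _ G hG _)

namespace WhileLang

/-- Process a certificate `a`: solve the problem on the graph of the vertices that are kept, and
compare the answer with the best one so far. -/
def stepVal (q : ℕ) (sol : Val → Val) (M a best : Val) : Val :=
  betterVal best (liftVal (keptVal q M a.hd) (sol (subMatrixVal (keptVal q M a.hd) M)))

/-- The branching algorithm, with a solver `sol` for graphs of small treewidth. -/
def mainVal (q c : ℕ) (sol : Val → Val) (M : Val) : Val :=
  (certificates (budgetVal q c M) M).toList.foldl (fun best a => stepVal q sol M a best) .nil

theorem encodeSet_injective {n : ℕ} : Function.Injective (encodeSet (n := n)) := by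
  intro A B h
  rw [encodeSet_eq, encodeSet_eq, tab_finRange, tab_finRange] at h
  have h1 := congrArg Val.toList h
  rw [Val.toList_ofList, Val.toList_ofList] at h1
  have h2 := List.ofFn_injective h1
  ext i
  have h3 := congrArg Val.test (congrFun h2 i)
  simpa using h3

theorem exists_marks {n : ℕ} {x : Val} (hx : x.len = n) :
    ∃ t : Fin n → Val, x = tab (List.finRange n) t := by
  subst hx
  exact ⟨x.toList.get, by rw [tab_finRange, List.ofFn_get, Val.ofList_toList]⟩

theorem card_protectedVertices {n : ℕ} (t : Fin n → Val) :
    (protectedVertices t).card = (tab (List.finRange n) t).toList.countP Val.test := by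
  rw [Val.toList_ofList, List.countP_map, countP_finRange]
  rfl

theorem two_pow_mul_lt (n : ℕ) :
    n * 2 ^ (2 * (Nat.log 2 n + 1)) < 3 ^ (2 * (Nat.log 2 n + 1)) := by
  have h1 : n < 2 ^ (Nat.log 2 n + 1) := Nat.lt_pow_succ_log_self (by norm_num) n
  rw [pow_mul, pow_mul]
  calc n * (2 ^ 2) ^ (Nat.log 2 n + 1) < 2 ^ (Nat.log 2 n + 1) * (2 ^ 2) ^ (Nat.log 2 n + 1) :=
        Nat.mul_lt_mul_of_pos_right h1 (by positivity)
    _ = 8 ^ (Nat.log 2 n + 1) := by rw [← mul_pow]; norm_num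
    _ ≤ _ := Nat.pow_le_pow_left (by norm_num) _

/-- The set of vertices kept for a certificate induces a subgraph of small treewidth. -/
theorem certificate_spec {D : GraphClass} (hD : D.Hereditary) {q s : ℕ}
    (hsep : ∀ r : ℕ, 1 ≤ r → ∀ (V : Type) [Fintype V] (G : SimpleGraph V), D.Mem G →
      Fintype.card V ≤ r ^ (q + 2) → (∀ v, (G.neighborSet v).ncard ≤ 2 * r ^ 2) →
      ∃ S : Finset V, IsBalancedSeparator G S ∧ S.card ≤ s * r ^ (q + 1))
    (c : ℕ) {n : ℕ} (G : SimpleGraph (Fin n)) (hG : D.Mem G) {a : Val}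
    (ha : a ∈ (certificates (budgetVal q c (encodeGraph G)) (encodeGraph G)).toList) :
    ∃ R : Finset (Fin n), keptVal q (encodeGraph G) a.hd = encodeSet R ∧
      ∀ (m : ℕ) (e : Fin m ↪ Fin n), (∀ v, v ∈ R ↔ ∃ i, e i = v) → treewidth (G.comap e) ≤
        (2 * c + 2) * (rootLen (q + 2) (encodeGraph G)).len ^ (q + 1) +
          s * (rootLen (q + 2) (encodeGraph G)).len ^ (q + 1) * (2 * (Nat.log 2 n + 1)) := by
  classical
  obtain ⟨h1, h2⟩ := certificates_sound _ _ a ha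
  rw [len_encodeGraph] at h1
  obtain ⟨t, ht⟩ := exists_marks h1
  rw [len_budgetVal, ht, ← card_protectedVertices] at h2
  obtain ⟨hr1, hrn, -⟩ := rootLen_spec (e := q + 2) (by omega) (encodeGraph G)
  rw [len_encodeGraph] at hrn
  refine ⟨_, by rw [ht, keptVal_eq], fun m e he => ?_⟩
  generalize (rootLen (q + 2) (encodeGraph G)).len = r at *
  have hmn : m ≤ n := by simpa using Fintype.card_le_of_embedding e
  refine (treewidth_le_of_powerSeparators hD (hsep r hr1) (G.comap e) (hD.mem_comap e hG)
    (by simpa using hmn.trans hrn) (d := 2 * (Nat.log 2 n + 1))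
    (by
      rw [Fintype.card_fin]
      exact lt_of_le_of_lt (Nat.mul_le_mul_right _ hmn) (two_pow_mul_lt n))
    (Finset.univ.filter fun i => e i ∈ protectedVertices t) fun v hv => ?_).trans
    (Nat.add_le_add_right (le_trans ?_ h2) _)
  · have hvZ : e v ∉ protectedVertices t := by simpa using hv
    have hvR := (he (e v)).2 ⟨v, rfl⟩
    rw [keptVertices, Finset.mem_filter] at hvR
    obtain ⟨-, hdeg⟩ := hvR.2.resolve_left hvZ
    rw [← Set.ncard_image_of_injective _ e.injective]
    have hsub : e '' (G.comap e).neighborSet v ⊆ (((survivors G (pivots t) (protectedVertices t)).filter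
        fun u => G.Adj (e v) u : Finset (Fin n)) : Set (Fin n)) := by
      rintro _ ⟨u, hu, rfl⟩
      have huR := (he (e u)).2 ⟨u, rfl⟩
      rw [keptVertices, Finset.mem_filter] at huR
      rw [Finset.mem_coe, Finset.mem_filter]
      refine ⟨huR.2.elim (fun h => ?_) fun h => h.1, hu⟩
      exact subset_survivors G _ _ h
    have h3 := Set.ncard_le_ncard hsub (Set.toFinite _)
    rw [Set.ncard_coe_finset] at h3
    have h4 : r ≤ r ^ 2 := Nat.le_self_pow (by norm_num) r
    omega
  · rw [← Finset.card_map e]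
    refine Finset.card_le_card fun v hv => ?_
    obtain ⟨i, hi, rfl⟩ := Finset.mem_map.1 hv
    exact (Finset.mem_filter.1 hi).2

/-- Every sparse set of vertices is kept for some certificate. -/
theorem exists_certificate (q c : ℕ) {n : ℕ} (G : SimpleGraph (Fin n)) (B : Finset (Fin n))
    (hB : (G.induce (B : Set (Fin n))).edgeSet.ncard ≤ c * n) :
    ∃ a ∈ (certificates (budgetVal q c (encodeGraph G)) (encodeGraph G)).toList,
      ∃ R : Finset (Fin n), keptVal q (encodeGraph G) a.hd = encodeSet R ∧ B ⊆ R := by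
  classical
  obtain ⟨hr1, hrn, -⟩ := rootLen_spec (e := q + 2) (by omega) (encodeGraph G)
  rw [len_encodeGraph] at hrn
  obtain ⟨P, Z, hPZ, hZ, hkept⟩ := exists_pivots G B c q _ hr1 (by simpa using hrn)
    (by simpa using hB)
  let t : Fin n → Val := fun i => if i ∈ P then .pivotMark else if i ∈ Z then .mark else .nil
  have hP : pivots t = P := by
    ext i
    simp only [pivots, t, Finset.mem_filter, Finset.mem_univ, true_and]
    split_ifs with h1 h2 <;> simp [h1, Val.tl]
  have hZ' : protectedVertices t = Z := by
    ext i
    simp only [protectedVertices, t, Finset.mem_filter, Finset.mem_univ, true_and]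
    split_ifs with h1 h2
    · simp [hPZ h1]
    · simp [h2]
    · simp [h2]
  obtain ⟨a, ha, hat⟩ := certificates_complete (budgetVal q c (encodeGraph G)) (encodeGraph G)
    (tab (List.finRange n) t).toList (by
      intro x hx
      rw [Val.toList_ofList, List.mem_map] at hx
      obtain ⟨i, -, rfl⟩ := hx
      simp only [t]
      split_ifs <;> simp) (by simp) (by
      rw [← card_protectedVertices, hZ', len_budgetVal]
      exact hZ)
  rw [Val.ofList_toList] at hat
  refine ⟨a, ha, _, by rw [hat, keptVal_eq], fun v hv => ?_⟩
  rw [hP, hZ', keptVertices, Finset.mem_filter]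
  exact ⟨Finset.mem_univ _, hkept v hv⟩

/-- The set that the answer `o` reports, if any, induces a graph of the class. -/
def IsSolution (C : GraphClass) {n : ℕ} (G : SimpleGraph (Fin n)) (o : Option (Finset (Fin n))) :
    Prop :=
  ∀ A, o = some A → C.Mem (G.induce (A : Set (Fin n)))

/-- The answer `o` is a set with at least `k` elements. -/
def AtLeast {n : ℕ} (o : Option (Finset (Fin n))) (k : ℕ) : Prop :=
  ∃ A, o = some A ∧ k ≤ A.card

theorem better_spec {n : ℕ} (o o' : Option (Finset (Fin n))) :
    (better o o' = o ∨ better o o' = o') ∧ (∀ k, AtLeast o k → AtLeast (better o o') k) ∧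
      ∀ k, AtLeast o' k → AtLeast (better o o') k := by
  rcases o with _ | A <;> rcases o' with _ | B
  · simp [better]
  · simp [better, AtLeast]
  · simp [better, AtLeast]
  · simp only [better, AtLeast, Option.some.injEq, exists_eq_left']
    split_ifs with h
    · refine ⟨Or.inr rfl, fun k hk => ?_, fun k hk => ?_⟩ <;> simp <;> omega
    · refine ⟨Or.inl rfl, fun k hk => ?_, fun k hk => ?_⟩ <;> simp <;> omega

section Correctness

variable {C D : GraphClass} {sol : Val → Val}

theorem stepVal_spec (hD : D.Hereditary)
    (hsol : ∀ (m : ℕ) (H : SimpleGraph (Fin m)), D.Mem H →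
      ∃ ans, IsMaxInducedAnswer C H ans ∧ sol (encodeGraph H) = encodeAnswer ans)
    (q : ℕ) {n : ℕ} (G : SimpleGraph (Fin n)) (hG : D.Mem G) {a : Val} {R : Finset (Fin n)}
    (hR : keptVal q (encodeGraph G) a.hd = encodeSet R) (o : Option (Finset (Fin n)))
    (ho : IsSolution C G o) :
    ∃ o', stepVal q sol (encodeGraph G) a (encodeAnswer o) = encodeAnswer o' ∧ IsSolution C G o' ∧
      (∀ k, AtLeast o k → AtLeast o' k) ∧
      ∀ B ⊆ R, C.Mem (G.induce (B : Set (Fin n))) → AtLeast o' B.card := by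
  classical
  obtain ⟨m, e, he, hsub, hlift⟩ := exists_embedding G R
  obtain ⟨ans, hans, hsolans⟩ := hsol m (G.comap e) (hD.mem_comap e hG)
  obtain ⟨h1, h2, h3⟩ := better_spec o (ans.map (Finset.map e))
  refine ⟨better o (ans.map (Finset.map e)), ?_, ?_, h2, fun B hB hBC => h3 _ ?_⟩
  · rw [stepVal, hR, hsub, hsolans, hlift, betterVal_encodeAnswer]
  · rcases h1 with h1 | h1 <;> rw [h1]
    · exact ho
    · intro A hA
      obtain ⟨A', rfl, rfl⟩ := Option.map_eq_some_iff.1 hA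
      exact (C.mem_induce_comap_iff e G A').1 hans.1
  · obtain ⟨B', rfl⟩ : ∃ B' : Finset (Fin m), B = B'.map e := by
      refine ⟨Finset.univ.filter fun i => e i ∈ B, ?_⟩
      ext v
      simp only [Finset.mem_map, Finset.mem_filter, Finset.mem_univ, true_and]
      constructor
      · intro hv
        obtain ⟨i, rfl⟩ := (he v).1 (hB hv)
        exact ⟨i, hv, rfl⟩
      · rintro ⟨i, hi, rfl⟩
        exact hi
    have hB' := (C.mem_induce_comap_iff e G B').2 hBC
    rcases ans with _ | A
    · exact absurd hB' (hans B')
    · exact ⟨A.map e, rfl, by simpa using hans.2 B' hB'⟩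

theorem mainVal_spec (hD : D.Hereditary)
    (hsol : ∀ (m : ℕ) (H : SimpleGraph (Fin m)), D.Mem H →
      ∃ ans, IsMaxInducedAnswer C H ans ∧ sol (encodeGraph H) = encodeAnswer ans)
    (q c : ℕ) {n : ℕ} (G : SimpleGraph (Fin n)) (hG : D.Mem G)
    (hkept : ∀ a ∈ (certificates (budgetVal q c (encodeGraph G)) (encodeGraph G)).toList,
      ∃ R : Finset (Fin n), keptVal q (encodeGraph G) a.hd = encodeSet R)
    (hsparse : ∀ B : Finset (Fin n), C.Mem (G.induce (B : Set (Fin n))) →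
      (G.induce (B : Set (Fin n))).edgeSet.ncard ≤ c * n) :
    ∃ ans, IsMaxInducedAnswer C G ans ∧ mainVal q c sol (encodeGraph G) = encodeAnswer ans := by
  have key : ∀ (l : List Val) (o : Option (Finset (Fin n))), IsSolution C G o →
      (∀ a ∈ l, ∃ R : Finset (Fin n), keptVal q (encodeGraph G) a.hd = encodeSet R) →
      ∃ o', l.foldl (fun best a => stepVal q sol (encodeGraph G) a best) (encodeAnswer o) =
        encodeAnswer o' ∧ IsSolution C G o' ∧ (∀ k, AtLeast o k → AtLeast o' k) ∧
        ∀ a ∈ l, ∀ R : Finset (Fin n), keptVal q (encodeGraph G) a.hd = encodeSet R →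
          ∀ B ⊆ R, C.Mem (G.induce (B : Set (Fin n))) → AtLeast o' B.card := by
    intro l
    induction l with
    | nil => intro o ho _; exact ⟨o, rfl, ho, fun _ h => h, by simp⟩
    | cons a l ih =>
      intro o ho hl
      obtain ⟨R, hR⟩ := hl a List.mem_cons_self
      obtain ⟨o1, h1, h2, h3, h4⟩ := stepVal_spec hD hsol q G hG hR o ho
      obtain ⟨o2, k1, k2, k3, k4⟩ := ih o1 h2 fun b hb => hl b (List.mem_cons_of_mem _ hb)
      refine ⟨o2, by rw [List.foldl_cons, h1, k1], k2, fun k hk => k3 k (h3 k hk), ?_⟩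
      intro b hb R' hR' B hB hBC
      rcases List.mem_cons.1 hb with rfl | hb
      · obtain rfl := encodeSet_injective (hR.symm.trans hR')
        exact k3 _ (h4 B hB hBC)
      · exact k4 b hb R' hR' B hB hBC
  obtain ⟨o, h1, h2, -, h4⟩ := key _ none (by intro A hA; simp at hA) hkept
  refine ⟨o, ?_, h1⟩
  have h5 : ∀ B : Finset (Fin n), C.Mem (G.induce (B : Set (Fin n))) → AtLeast o B.card := by
    intro B hB
    obtain ⟨a, ha, R, hR, hBR⟩ := exists_certificate q c G B (hsparse B hB)
    exact h4 a ha R hR B hBR hB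
  rcases o with _ | A
  · intro B hB
    obtain ⟨A, hA, -⟩ := h5 B hB
    simp at hA
  · refine ⟨h2 A rfl, fun B hB => ?_⟩
    obtain ⟨A', hA', hle⟩ := h5 B hB
    obtain rfl := Option.some.inj hA'
    exact hle

end Correctness

/-! ### The running time of the branching algorithm -/

theorem size_encodeAnswer_le {n : ℕ} (o : Option (Finset (Fin n))) :
    (encodeAnswer o).size ≤ 4 * n + 3 := by
  rcases o with _ | A
  · simp [encodeAnswer, Val.size]
  · have h1 := List.sum_le_card_nsmul
      (((List.finRange n).map fun i => encodeBool (decide (i ∈ A))).map fun a => a.size + 1) 4 (by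
        intro x hx
        rw [List.map_map, List.mem_map] at hx
        obtain ⟨i, -, rfl⟩ := hx
        simp only [Function.comp_apply]
        cases decide (i ∈ A) <;> simp [encodeBool, Val.size])
    simp only [List.length_map, List.length_finRange, smul_eq_mul] at h1
    simp only [encodeAnswer, Val.size, encodeSet_eq, Val.size_ofList]
    omega

theorem size_encodeGraph_le {n : ℕ} (G : SimpleGraph (Fin n)) :
    (encodeGraph G).size ≤ 4 * (n + 1) ^ 2 := by
  classical
  have hrow : ∀ i : Fin n, (tab (List.finRange n) fun j =>
      encodeBool (decide (G.Adj i j))).size ≤ 4 * n + 1 := by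
    intro i
    have h1 := List.sum_le_card_nsmul
      (((List.finRange n).map fun j => encodeBool (decide (G.Adj i j))).map fun a => a.size + 1) 4
      (by
        intro x hx
        rw [List.map_map, List.mem_map] at hx
        obtain ⟨j, -, rfl⟩ := hx
        simp only [Function.comp_apply]
        cases decide (G.Adj i j) <;> simp [encodeBool, Val.size])
    simp only [List.length_map, List.length_finRange, smul_eq_mul] at h1
    rw [Val.size_ofList]
    omega
  rw [encodeGraph_eq, Val.size_ofList]
  have h2 := List.sum_le_card_nsmul (((List.finRange n).map fun i => tab (List.finRange n) fun j =>
      encodeBool (decide (G.Adj i j))).map fun a => a.size + 1) (4 * n + 2) (by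
        intro x hx
        rw [List.map_map, List.mem_map] at hx
        obtain ⟨i, -, rfl⟩ := hx
        simp only [Function.comp_apply]
        have := hrow i
        omega)
  simp only [List.length_map, List.length_finRange, smul_eq_mul] at h2
  nlinarith

/-- The time is polynomial in the size of the input and the number of certificates, times the
maximal time `U` that the solver takes for a certificate. -/
theorem runsIn_mainVal {C D : GraphClass} {sol : Val → Val} {Ts : Val → ℕ} (hD : D.Hereditary)
    (hsol : ∀ (m : ℕ) (H : SimpleGraph (Fin m)), D.Mem H →
      ∃ ans, IsMaxInducedAnswer C H ans ∧ sol (encodeGraph H) = encodeAnswer ans)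
    (hrun : RunsIn (fun y => ∃ (m : ℕ) (H : SimpleGraph (Fin m)), D.Mem H ∧ y = encodeGraph H)
      sol Ts) (q c : ℕ) (U : ℕ → ℕ)
    (hU : ∀ (n : ℕ) (G : SimpleGraph (Fin n)), D.Mem G →
      ∀ a ∈ (certificates (budgetVal q c (encodeGraph G)) (encodeGraph G)).toList,
        (∃ R : Finset (Fin n), keptVal q (encodeGraph G) a.hd = encodeSet R) ∧
        Ts (subMatrixVal (keptVal q (encodeGraph G) a.hd) (encodeGraph G)) ≤ U n) :
    ∃ k : ℕ, RunsIn (fun x => ∃ (n : ℕ) (G : SimpleGraph (Fin n)), D.Mem G ∧ x = encodeGraph G)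
      (mainVal q c sol)
      (fun x => ((x.size + 2) * certificateCount (budgetVal q c x) x) ^ k * (U x.len + 1)) := by
  obtain ⟨Ps, hPs⟩ : ∃ Ps : Val → Prop, Ps = fun y =>
    ∃ (m : ℕ) (H : SimpleGraph (Fin m)), D.Mem H ∧ y = encodeGraph H := ⟨_, rfl⟩
  rw [← hPs] at hrun ⊢
  obtain ⟨pre, hpre⟩ : ∃ pre : Val → Val, pre = fun y =>
    subMatrixVal (keptVal q y.hd y.tl.hd.hd) y.hd := ⟨_, rfl⟩
  have hkeptP : PolyTime fun y => keptVal q y.hd y.tl.hd.hd :=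
    (polyTime_keptVal q).comp₂ .hd' PolyTime.id.tl.hd.hd
  have hpreP : PolyTime pre := hpre ▸ polyTime_subMatrixVal.comp₂ hkeptP .hd'
  have hpostP : PolyTime fun z =>
      betterVal z.hd.tl.tl (liftVal (keptVal q z.hd.hd z.hd.tl.hd.hd) z.tl) :=
    polyTime_betterVal.comp₂ PolyTime.id.hd.tl.tl
      (polyTime_liftVal.comp₂ (hkeptP.comp .hd') .tl')
  obtain ⟨-, T1, ⟨k1, hk1⟩, hrun1⟩ := hpreP
  obtain ⟨-, T2, ⟨k2, hk2⟩, hrun2⟩ := hpostP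
  have hstep : RunsIn (fun y => Ps (pre y)) (fun y => stepVal q sol y.hd y.tl.hd y.tl.tl)
      (fun y => 1 + (T1 y + Ts (pre y)) + 10 + T2 (.cons y (sol (pre y)))) := by
    have h1 := hrun.comp (hrun1.mono (P' := fun y => Ps (pre y)) (fun _ _ => trivial)
      fun _ _ => le_rfl) fun _ h => h
    have h2 := hrun2.comp ((RunsIn.id _).cons h1) fun _ _ => trivial
    rw [hpre] at h2 ⊢
    exact h2
  obtain ⟨k0, hcert⟩ := runsIn_certificates (polyTime_budgetVal q c)
  obtain ⟨E, hE⟩ : ∃ E : Val → ℕ, E = fun x => 20 * x.size + (budgetVal q c x).size + 30 := ⟨_, rfl⟩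
  have hEP : PolyBounded E := hE ▸ ((((PolyBounded.const 20).mul .size).add
    (polyTime_budgetVal q c).1).add (.const 30))
  obtain ⟨p, hp⟩ : ∃ p : Val → ℕ, p = fun x => E x ^ k1 + E x ^ k2 + 11 := ⟨_, rfl⟩
  have hpP : PolyBounded fun x => p x + 62 :=
    (hp ▸ ((hEP.pow k1).add (hEP.pow k2)).add (.const 11)).add (.const 62)
  have hfold := RunsIn.foldl (P := Ps) (g := fun _ => .nil)
    (h := fun x => certificates (budgetVal q c x) x) (F := fun M a best => stepVal q sol M a best)
    (B := fun x => p x + U x.len) (.nil _)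
    (hcert.mono (fun _ _ => trivial) fun _ _ => le_rfl) hstep
    (fun x l acc => ∃ (n : ℕ) (G : SimpleGraph (Fin n)), D.Mem G ∧ x = encodeGraph G ∧
      ∃ o : Option (Finset (Fin n)), acc = encodeAnswer o ∧ IsSolution C G o)
    (fun x hx => by
      rw [hPs] at hx
      obtain ⟨n, G, hG, rfl⟩ := hx
      exact ⟨n, G, hG, rfl, none, rfl, by intro A hA; simp at hA⟩) (by
      rintro x - a l acc hl ⟨n, G, hG, rfl, o, rfl, ho⟩
      have ha := hl.subset List.mem_cons_self
      obtain ⟨⟨R, hR⟩, hTs⟩ := hU n G hG a ha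
      obtain ⟨m, e, he, hsub, -⟩ := exists_embedding G R
      have hpre' : pre (.cons (encodeGraph G) (.cons a (encodeAnswer o))) =
          encodeGraph (G.comap e) := by
        rw [hpre]
        simp only [Val.hd_cons, Val.tl_cons]
        rw [hR, hsub]
      obtain ⟨ans, -, hans⟩ := hsol m _ (hD.mem_comap e hG)
      have hmn : m ≤ n := by simpa using Fintype.card_le_of_embedding e
      refine ⟨?_, ?_, ?_⟩
      · rw [hPs, hpre']
        exact ⟨m, _, hD.mem_comap e hG, rfl⟩
      · rw [hpre', hans, ← hsub, ← hR]
        have hn : n < (encodeGraph G).size := by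
          have := Val.length_toList_lt (encodeGraph G)
          rwa [← Val.len, len_encodeGraph] at this
        have s1 := size_encodeAnswer_le o
        have s2 := size_encodeAnswer_le ans
        have s3 := (certificateInv_certificates (budgetVal q c (encodeGraph G)) (encodeGraph G)).1 a ha
        rw [len_encodeGraph] at s3
        have t1 := (hk1 (.cons (encodeGraph G) (.cons a (encodeAnswer o)))).trans
          (Nat.pow_le_pow_left (show _ ≤ E (encodeGraph G) by
            rw [hE]; simp only [Val.size]; omega) k1)
        have t2 := (hk2 (.cons (.cons (encodeGraph G) (.cons a (encodeAnswer o)))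
          (encodeAnswer ans))).trans (Nat.pow_le_pow_left (show _ ≤ E (encodeGraph G) by
            rw [hE]; simp only [Val.size]; omega) k2)
        rw [hp, len_encodeGraph]
        simp only
        omega
      · obtain ⟨o', h1, h2, -⟩ := stepVal_spec hD hsol q G hG hR o ho
        exact ⟨n, G, hG, rfl, o', h1, h2⟩)
  obtain ⟨k3, hk3⟩ := hpP
  refine ⟨k0 + k3 + 2, hfold.mono (fun _ h => h) fun x _ => ?_⟩
  have hN := certificateCount_pos (budgetVal q c x) x
  have hlen : (certificates (budgetVal q c x) x).toList.length ≤
      certificateCount (budgetVal q c x) x := (certificateInv_certificates _ _).size_le.1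
  have hk := hk3 x
  generalize certificateCount (budgetVal q c x) x = N at *
  generalize (certificates (budgetVal q c x) x).toList.length = len at *
  generalize hs : x.size + 2 = s at *
  generalize U x.len = u at *
  have hs2 : 2 ≤ s := by omega
  have hsN : 1 ≤ s * N := Nat.one_le_iff_ne_zero.2 (by positivity)
  have e1 : len * (p x + u + 20) ≤ N * (p x + u + 20) := Nat.mul_le_mul_right _ hlen
  have e2 : 2 + N * (p x + u + 20) + 40 ≤ N * ((p x + 62) * (u + 1)) := by
    calc 2 + N * (p x + u + 20) + 40 ≤ N * 42 + N * (p x + u + 20) := by omega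
      _ = N * (p x + u + 62) := by ring
      _ ≤ _ := Nat.mul_le_mul_left _ (by nlinarith)
  have e3 : N * ((p x + 62) * (u + 1)) ≤ (s * N) ^ (k3 + 1) * (u + 1) := by
    rw [← mul_assoc]
    refine Nat.mul_le_mul_right _ ?_
    calc N * (p x + 62) ≤ (s * N) * (s * N) ^ k3 := by
          refine Nat.mul_le_mul (Nat.le_mul_of_pos_left _ (by omega)) (hk.trans ?_)
          exact Nat.pow_le_pow_left (Nat.le_mul_of_pos_right _ hN) _
      _ = _ := by ring
  have e4 : (s * N) ^ (k3 + 1) ≤ (s * N) ^ (k0 + k3 + 1) := Nat.pow_le_pow_right hsN (by omega)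
  have e5 : (s * N) ^ k0 ≤ (s * N) ^ (k0 + k3 + 1) := Nat.pow_le_pow_right hsN (by omega)
  have e6 : 2 * (s * N) ^ (k0 + k3 + 1) ≤ (s * N) ^ (k0 + k3 + 2) := by
    rw [pow_succ _ (k0 + k3 + 1), mul_comm]
    exact Nat.mul_le_mul_left _ (by nlinarith)
  generalize (s * N) ^ (k3 + 1) = y1 at *
  generalize (s * N) ^ (k0 + k3 + 1) = y2 at *
  generalize (s * N) ^ (k0 + k3 + 2) = y3 at *
  nlinarith [Nat.mul_le_mul_right (u + 1) e4, Nat.mul_le_mul_right (u + 1) e6,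
    Nat.le_mul_of_pos_right y2 (Nat.succ_pos u)]

end WhileLang

namespace WhileLang

/-! ### The solver for graphs of small treewidth -/

theorem encodeGraph_injective {n : ℕ} : Function.Injective (encodeGraph (n := n)) := by
  classical
  intro G H h
  rw [encodeGraph_eq, encodeGraph_eq, tab_finRange, tab_finRange] at h
  have h1 := congrArg Val.toList h
  rw [Val.toList_ofList, Val.toList_ofList] at h1
  have h2 := List.ofFn_injective h1
  ext i j
  have h3 := congrArg Val.toList (congrFun h2 i)
  rw [tab_finRange, tab_finRange, Val.toList_ofList, Val.toList_ofList] at h3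
  have h4 := congrArg Val.test (congrFun (List.ofFn_injective h3) j)
  simpa using h4

/-- The answers of a program, as a function on trees. -/
theorem exists_solver {C D : GraphClass} {T : ∀ {n : ℕ}, SimpleGraph (Fin n) → ℝ}
    (h : MaxInducedSolvableInTime C D T) :
    ∃ (sol : Val → Val) (Ts : Val → ℕ) (b : ℕ),
      (∀ (m : ℕ) (H : SimpleGraph (Fin m)), D.Mem H →
        ∃ ans, IsMaxInducedAnswer C H ans ∧ sol (encodeGraph H) = encodeAnswer ans) ∧
      RunsIn (fun y => ∃ (m : ℕ) (H : SimpleGraph (Fin m)), D.Mem H ∧ y = encodeGraph H) sol Ts ∧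
      ∀ (m : ℕ) (H : SimpleGraph (Fin m)), D.Mem H → (Ts (encodeGraph H) : ℝ) ≤ T H + b := by
  obtain ⟨p, hp⟩ := h
  choose ans t hans hout ht using hp
  let I : Type := Σ n : ℕ, {G : SimpleGraph (Fin n) // D.Mem G}
  let enc : I → Val := fun i => encodeGraph i.2.1
  have henc : Function.Injective enc := by
    rintro ⟨n, G, hG⟩ ⟨m, H, hH⟩ h
    have h' : encodeGraph G = encodeGraph H := h
    obtain rfl : n = m := by simpa using congrArg Val.len h'
    obtain rfl := encodeGraph_injective h'
    rfl
  let sol := Function.extend enc (fun i => encodeAnswer (ans i.1 i.2.1 i.2.2)) fun _ => .nil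
  let T0 := Function.extend enc (fun i => t i.1 i.2.1 i.2.2) fun _ => 0
  have hsol : ∀ m (H : SimpleGraph (Fin m)) (hH : D.Mem H),
      sol (encodeGraph H) = encodeAnswer (ans m H hH) := fun m H hH =>
    henc.extend_apply _ _ (⟨m, H, hH⟩ : I)
  have hT0 : ∀ m (H : SimpleGraph (Fin m)) (hH : D.Mem H),
      T0 (encodeGraph H) = t m H hH := fun m H hH =>
    henc.extend_apply _ _ (⟨m, H, hH⟩ : I)
  refine ⟨sol, fun y => T0 y + (2 * p.bound + 1), 2 * p.bound + 1,
    fun m H hH => ⟨_, hans m H hH, hsol m H hH⟩, RunsIn.of_outputs p ?_, fun m H hH => ?_⟩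
  · rintro y ⟨m, H, hH, rfl⟩
    refine ⟨t m H hH, ?_, (hT0 m H hH).ge⟩
    rw [hsol m H hH]
    exact hout m H hH
  · push_cast
    rw [hT0 m H hH]
    have := ht m H hH
    linarith

end WhileLang

/-! ### Asymptotics -/

theorem le_two_rpow_logb {z : ℝ} (hz : 0 < z) : z ≤ 2 ^ Real.logb 2 z :=
  (Real.rpow_logb (by norm_num) (by norm_num) hz).ge

theorem logb_two_le {z : ℝ} (hz : 0 < z) : Real.logb 2 z ≤ 2 * z := by
  have h1 : Real.log z ≤ z := (Real.log_le_sub_one_of_pos hz).trans (by linarith)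
  have h2 : (1 / 2 : ℝ) < Real.log 2 := by have := Real.log_two_gt_d9; linarith
  rw [Real.logb, div_le_iff₀ (by linarith)]
  nlinarith

/-- The polylogarithmic factors are absorbed by the logarithm of `n ^ a`, as `a ≥ 1 / 2`. -/
theorem add_two_le_sq {n q : ℕ} :
    (n : ℝ) + 2 ≤ ((n : ℝ) ^ (((q : ℝ) + 1) / ((q : ℝ) + 2)) + 2) ^ 2 := by
  have h0 : (0 : ℝ) ≤ (n : ℝ) ^ (((q : ℝ) + 1) / ((q : ℝ) + 2)) := by positivity
  rcases Nat.eq_zero_or_pos n with rfl | hn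
  · simp only [Nat.cast_zero] at h0 ⊢
    nlinarith
  · have h1 : (1 : ℝ) ≤ n := by exact_mod_cast hn
    have h2 : (n : ℝ) ≤ ((n : ℝ) ^ (((q : ℝ) + 1) / ((q : ℝ) + 2))) ^ 2 := by
      rw [← Real.rpow_natCast, ← Real.rpow_mul (by positivity)]
      refine Real.self_le_rpow_of_one_le h1 ?_
      rw [div_mul_eq_mul_div, le_div_iff₀ (by positivity)]
      push_cast
      have : (0 : ℝ) ≤ q := by positivity
      linarith
    nlinarith

/-- The power `r ^ (q + 1)` of the rounded root `r` of `n` is of the order of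
`n ^ ((q + 1) / (q + 2))`. -/
theorem root_pow_le {n q r : ℕ} (hr : r = 1 ∨ (r - 1) ^ (q + 2) < n) :
    (r : ℝ) ^ (q + 1) ≤ 2 ^ (q + 1) * ((n : ℝ) ^ (((q : ℝ) + 1) / ((q : ℝ) + 2)) + 1) := by
  have h0 : (0 : ℝ) ≤ (n : ℝ) ^ (((q : ℝ) + 1) / ((q : ℝ) + 2)) := by positivity
  have h2 : (1 : ℝ) ≤ 2 ^ (q + 1) := one_le_pow₀ (by norm_num)
  by_cases hr1 : r ≤ 1
  · have : (r : ℝ) ^ (q + 1) ≤ 1 := pow_le_one₀ (by positivity) (by exact_mod_cast hr1)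
    nlinarith
  · have h3 := hr.resolve_left (by omega)
    obtain ⟨j, rfl⟩ : ∃ j, r = j + 1 := ⟨r - 1, by omega⟩
    rw [Nat.add_sub_cancel] at h3
    have hj : 1 ≤ j := by omega
    have h4 : ((j : ℝ)) ^ (q + 1) ≤ (n : ℝ) ^ (((q : ℝ) + 1) / ((q : ℝ) + 2)) := by
      have h5 : ((j : ℝ) ^ (q + 2)) ≤ n := by exact_mod_cast h3.le
      have h6 := Real.rpow_le_rpow (by positivity) h5
        (show (0 : ℝ) ≤ ((q : ℝ) + 1) / ((q : ℝ) + 2) by positivity)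
      refine le_trans (le_of_eq ?_) h6
      rw [← Real.rpow_natCast, ← Real.rpow_natCast, ← Real.rpow_mul (by positivity)]
      congr 1
      push_cast
      field_simp
    have h7 : ((j + 1 : ℕ) : ℝ) ≤ 2 * j := by
      have : (1 : ℝ) ≤ j := by exact_mod_cast hj
      push_cast
      linarith
    calc ((j + 1 : ℕ) : ℝ) ^ (q + 1) ≤ (2 * (j : ℝ)) ^ (q + 1) := by gcongr
      _ = 2 ^ (q + 1) * (j : ℝ) ^ (q + 1) := mul_pow _ _ _
      _ ≤ _ := by
        refine mul_le_mul_of_nonneg_left ?_ (by positivity)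
        linarith

/-- If `f = Õ(w)` then `2 ^ f w = 2 ^ Õ(X)` for all `w = O(X log X)`. -/
theorem softO_comp_le {f : ℕ → ℝ} (hf : SoftO f fun w => (w : ℝ)) (C : ℝ) (hC : 0 ≤ C) :
    ∃ (c : ℝ) (k : ℕ), 0 ≤ c ∧ ∀ (w : ℕ) (X : ℝ), 0 ≤ X →
      (w : ℝ) ≤ C * (X + 1) * Real.logb 2 (X + 2) →
      f w ≤ c * (X + 1) * Real.logb 2 (X + 2) ^ (k + 1) := by
  obtain ⟨c, k, hf⟩ := hf
  obtain ⟨E, hE⟩ : ∃ E : ℝ, E = Real.logb 2 (2 * (C + 2)) + 2 := ⟨_, rfl⟩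
  have hE0 : 0 ≤ Real.logb 2 (2 * (C + 2)) := Real.logb_nonneg (by norm_num) (by linarith)
  have hE1 : 0 ≤ E := by linarith
  refine ⟨|c| * (C + 1) * E ^ k, k, by positivity, fun w X hX hw => ?_⟩
  obtain ⟨L, hL⟩ : ∃ L, L = Real.logb 2 (X + 2) := ⟨_, rfl⟩
  rw [← hL] at hw ⊢
  have hL1 : 1 ≤ L := by
    rw [hL, Real.le_logb_iff_rpow_le (by norm_num) (by linarith)]
    simpa using hX
  have hL2 : L ≤ 2 * (X + 2) := hL ▸ logb_two_le (by linarith)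
  have hYL : 1 ≤ (X + 1) * L := by nlinarith
  have hw0 : (0 : ℝ) ≤ w := by positivity
  have h1 : (w : ℝ) + 1 ≤ (C + 1) * ((X + 1) * L) := by nlinarith
  have h2 : (w : ℝ) + 2 ≤ 2 * (C + 2) * (X + 2) ^ 2 := by
    have h3 : (w : ℝ) + 2 ≤ (C + 2) * ((X + 1) * L) := by nlinarith
    have h4 : (X + 1) * L ≤ (X + 2) * (2 * (X + 2)) :=
      mul_le_mul (by linarith) hL2 (by linarith) (by linarith)
    nlinarith [mul_le_mul_of_nonneg_left h4 (show 0 ≤ C + 2 by linarith)]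
  have h5 : Real.logb 2 ((w : ℝ) + 2) ≤ E * L := by
    calc Real.logb 2 ((w : ℝ) + 2) ≤ Real.logb 2 (2 * (C + 2) * (X + 2) ^ 2) :=
          Real.logb_le_logb_of_le (by norm_num) (by linarith) h2
      _ = Real.logb 2 (2 * (C + 2)) + 2 * L := by
          rw [Real.logb_mul (by positivity) (by positivity), Real.logb_pow, hL]
          norm_num
      _ ≤ E * L := by rw [hE]; nlinarith
  have h6 : 0 ≤ Real.logb 2 ((w : ℝ) + 2) := Real.logb_nonneg (by norm_num) (by linarith)
  calc f w ≤ c * ((w : ℝ) + 1) * Real.logb 2 ((w : ℝ) + 2) ^ k := hf w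
    _ ≤ |c| * ((w : ℝ) + 1) * Real.logb 2 ((w : ℝ) + 2) ^ k := by
        gcongr
        exact le_abs_self c
    _ ≤ |c| * ((C + 1) * ((X + 1) * L)) * (E * L) ^ k := by gcongr
    _ = _ := by ring

open WhileLang in
/-- The branching algorithm runs in time `2 ^ Õ(n ^ a)` with `a = (q + 1) / (q + 2)`: the number of
certificates, the treewidth of the graphs that are kept, and the size of the input are all bounded
by `2 ^ Õ(n ^ a)` or `Õ(n ^ a)`, and polylogarithmic factors are absorbed. -/
theorem solvableInSubexpTime_of_powerSeparators {C D : GraphClass} (hsparse : C.LinearlySparse)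
    (hD : D.Hereditary) (htw : SolvableInTreewidthTime C D) {q : ℕ} (hsep : D.PowerSeparators q) :
    SolvableInSubexpTime C D (((q : ℝ) + 1) / ((q : ℝ) + 2)) := by
  classical
  obtain ⟨c', hc'⟩ := hsparse
  obtain ⟨c, hc⟩ : ∃ c : ℕ, c = ⌈c'⌉₊ := ⟨_, rfl⟩
  have hedges : ∀ {n : ℕ} (G : SimpleGraph (Fin n)) (B : Finset (Fin n)),
      C.Mem (G.induce (B : Set (Fin n))) →
      (G.induce (B : Set (Fin n))).edgeSet.ncard ≤ c * n := by
    intro n G B hB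
    have h1 := hc' _ _ hB
    have h2 : Fintype.card (B : Set (Fin n)) ≤ n := by
      simpa using Fintype.card_subtype_le fun i => i ∈ (B : Set (Fin n))
    have h3 : ((G.induce (B : Set (Fin n))).edgeSet.ncard : ℝ) ≤ c * n :=
      calc _ ≤ c' * Fintype.card (B : Set (Fin n)) := h1
        _ ≤ c * Fintype.card (B : Set (Fin n)) :=
          mul_le_mul_of_nonneg_right (hc ▸ Nat.le_ceil c') (by positivity)
        _ ≤ c * n := mul_le_mul_of_nonneg_left (by exact_mod_cast h2) (by positivity)
    exact_mod_cast h3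
  obtain ⟨f, d, hf, htw⟩ := htw
  obtain ⟨sol, Ts, b, hsol, hrun, hTs⟩ := exists_solver htw
  obtain ⟨s, hsep⟩ := hsep
  obtain ⟨X, hX⟩ : ∃ X : ℕ → ℝ, X = fun n : ℕ => (n : ℝ) ^ (((q : ℝ) + 1) / ((q : ℝ) + 2)) := ⟨_, rfl⟩
  have hX0 : ∀ n, 0 ≤ X n := fun n => by rw [hX]; positivity
  obtain ⟨L, hL⟩ : ∃ L : ℕ → ℝ, L = fun n => Real.logb 2 (X n + 2) := ⟨_, rfl⟩
  have hL1 : ∀ n, 1 ≤ L n := fun n => by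
    rw [hL, Real.le_logb_iff_rpow_le (by norm_num) (by linarith [hX0 n])]
    simpa using hX0 n
  have hn2 : ∀ n : ℕ, (n : ℝ) + 2 ≤ 2 ^ (2 * L n) := fun n => by
    have h1 : X n + 2 ≤ 2 ^ L n := hL ▸ le_two_rpow_logb (by linarith [hX0 n])
    calc (n : ℝ) + 2 ≤ (X n + 2) ^ 2 := by rw [hX]; exact add_two_le_sq
      _ ≤ ((2 : ℝ) ^ L n) ^ 2 := pow_le_pow_left₀ (by linarith [hX0 n]) h1 2
      _ = 2 ^ (2 * L n) := by rw [← Real.rpow_natCast, ← Real.rpow_mul (by norm_num)]; ring_nf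
  have hlog : ∀ n : ℕ, ((Nat.log 2 n : ℕ) : ℝ) ≤ 2 * L n := fun n => by
    rcases Nat.eq_zero_or_pos n with rfl | hn
    · have := hL1 0
      simp
      linarith
    · have h1 : (2 : ℝ) ^ ((Nat.log 2 n : ℕ) : ℝ) ≤ 2 ^ (2 * L n) := by
        rw [Real.rpow_natCast]
        have h2 : ((2 ^ Nat.log 2 n : ℕ) : ℝ) ≤ n := by exact_mod_cast Nat.pow_log_le_self 2 hn.ne'
        push_cast at h2
        linarith [hn2 n]
      exact (Real.rpow_le_rpow_left_iff (by norm_num)).1 h1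
  -- the number of protected vertices and the treewidth are at most `A * (X + 1) * L`
  obtain ⟨A, hA⟩ : ∃ A : ℝ, A = (2 * c + 2 + 6 * s) * 2 ^ (q + 1) := ⟨_, rfl⟩
  have hA0 : 0 ≤ A := by rw [hA]; positivity
  have hroot : ∀ {n : ℕ} (G : SimpleGraph (Fin n)),
      ((rootLen (q + 2) (encodeGraph G)).len : ℝ) ^ (q + 1) ≤ 2 ^ (q + 1) * (X n + 1) := by
    intro n G
    have h1 := (rootLen_spec (e := q + 2) (by omega) (encodeGraph G)).2.2
    rw [len_encodeGraph] at h1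
    rw [hX]
    exact root_pow_le h1
  obtain ⟨B, k, hB0, hB⟩ := softO_comp_le hf A hA0
  obtain ⟨U, hU⟩ : ∃ U : ℕ → ℕ, U = fun n =>
    ⌊(2 : ℝ) ^ (B * (X n + 1) * L n ^ (k + 1)) * ((n : ℝ) + 1) ^ d + b⌋₊ := ⟨_, rfl⟩
  obtain ⟨kk, hmain⟩ := runsIn_mainVal hD hsol hrun q c U (by
    intro n G hG a ha
    obtain ⟨R, hR, htwR⟩ := certificate_spec hD hsep c G hG ha
    refine ⟨⟨R, hR⟩, ?_⟩
    obtain ⟨m, e, he, hsub, -⟩ := exists_embedding G R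
    rw [hR, hsub, hU]
    have hmn : m ≤ n := by simpa using Fintype.card_le_of_embedding e
    refine Nat.le_floor ((hTs m _ (hD.mem_comap e hG)).trans ?_)
    have h1 : (treewidth (G.comap e) : ℝ) ≤ A * (X n + 1) * L n := by
      have h2 : (treewidth (G.comap e) : ℝ) ≤
          (2 * c + 2) * ((rootLen (q + 2) (encodeGraph G)).len : ℝ) ^ (q + 1) +
          s * ((rootLen (q + 2) (encodeGraph G)).len : ℝ) ^ (q + 1) *
            (2 * ((Nat.log 2 n : ℕ) + 1)) := by exact_mod_cast htwR m e he
      have h3 := hroot G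
      generalize ((rootLen (q + 2) (encodeGraph G)).len : ℝ) ^ (q + 1) = z at *
      have h4 : 2 * (((Nat.log 2 n : ℕ) : ℝ) + 1) ≤ 6 * L n := by linarith [hlog n, hL1 n]
      have h5 : 0 ≤ 2 ^ (q + 1) * (X n + 1) := by have := hX0 n; positivity
      have h6 : 0 ≤ L n := by linarith [hL1 n]
      calc (treewidth (G.comap e) : ℝ) ≤ _ := h2
        _ ≤ (2 * c + 2) * (2 ^ (q + 1) * (X n + 1)) + s * (2 ^ (q + 1) * (X n + 1)) * (6 * L n) := by
            gcongr
        _ ≤ (2 * c + 2) * (2 ^ (q + 1) * (X n + 1)) * L n +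
            s * (2 ^ (q + 1) * (X n + 1)) * (6 * L n) := by
            have : 0 ≤ (2 * (c : ℝ) + 2) * (2 ^ (q + 1) * (X n + 1)) := by positivity
            nlinarith [hL1 n]
        _ = A * (X n + 1) * L n := by rw [hA]; ring
    have h2 := hB _ (X n) (hX0 n) (by rw [hL] at h1; exact h1)
    have h3 : (2 : ℝ) ^ f (treewidth (G.comap e)) ≤ 2 ^ (B * (X n + 1) * L n ^ (k + 1)) := by
      refine Real.rpow_le_rpow_of_exponent_le (by norm_num) ?_
      rw [hL]
      exact h2
    have h4 : ((m : ℝ) + 1) ^ d ≤ ((n : ℝ) + 1) ^ d := by gcongr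
    have h5 := mul_le_mul h3 h4 (by positivity) (by positivity)
    linarith)
  obtain ⟨E, hE⟩ : ∃ E : ℝ, E = kk * (8 + 4 * A) + (b + 2) + B + 2 * d := ⟨_, rfl⟩
  refine ⟨fun n => E * (X n + 1) * L n ^ (k + 1), ⟨E, k + 1, fun m => ?_⟩, ?_⟩
  · rw [hL, hX]
  obtain ⟨p, hp⟩ := hmain
  refine ⟨p, fun n G hG => ?_⟩
  obtain ⟨ans, hans, hval⟩ := mainVal_spec hD hsol q c G hG
    (fun a ha => by
      obtain ⟨R, hR, -⟩ := certificate_spec hD hsep c G hG ha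
      exact ⟨R, hR⟩) fun B hB => hedges G B hB
  obtain ⟨t, s', hexec, hout, ht⟩ := hp (initStore (encodeGraph G)) ⟨n, G, hG, rfl⟩
  refine ⟨ans, t, hans, ⟨s', hexec, hout.trans hval⟩, ?_⟩
  change t ≤ (((encodeGraph G).size + 2) * certificateCount (budgetVal q c (encodeGraph G))
    (encodeGraph G)) ^ kk * (U (encodeGraph G).len + 1) at ht
  rw [len_encodeGraph] at ht
  have ht' : (t : ℝ) ≤ ((((encodeGraph G).size + 2 : ℕ) : ℝ) *
      ((certificateCount (budgetVal q c (encodeGraph G)) (encodeGraph G) : ℕ) : ℝ)) ^ kk *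
      ((U n : ℝ) + 1) := by exact_mod_cast ht
  have hL0 : 0 ≤ L n := by linarith [hL1 n]
  have hYL : 1 ≤ (X n + 1) * L n := by nlinarith [hX0 n, hL1 n]
  have h1 : (((encodeGraph G).size + 2 : ℕ) : ℝ) ≤ 2 ^ (8 * L n) := by
    have h2 : (encodeGraph G).size + 2 ≤ (n + 2) ^ 4 := by
      have h3 := size_encodeGraph_le G
      have h4 : (n + 2) ^ 2 = (n + 1) ^ 2 + 2 * n + 3 := by ring
      calc (encodeGraph G).size + 2 ≤ 4 * (n + 2) ^ 2 := by omega
        _ ≤ (n + 2) ^ 2 * (n + 2) ^ 2 :=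
          Nat.mul_le_mul_right _ (Nat.pow_le_pow_left (show 2 ≤ n + 2 by omega) 2)
        _ = _ := by ring
    calc (((encodeGraph G).size + 2 : ℕ) : ℝ) ≤ ((n : ℝ) + 2) ^ 4 := by exact_mod_cast h2
      _ ≤ ((2 : ℝ) ^ (2 * L n)) ^ 4 := pow_le_pow_left₀ (by positivity) (hn2 n) 4
      _ = _ := by rw [← Real.rpow_natCast, ← Real.rpow_mul (by norm_num)]; ring_nf
  have h2 : ((certificateCount (budgetVal q c (encodeGraph G)) (encodeGraph G) : ℕ) : ℝ) ≤
      2 ^ (4 * A * ((X n + 1) * L n)) := by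
    rw [certificateCount, len_encodeGraph]
    have h3 : ((budgetVal q c (encodeGraph G)).len : ℝ) ≤ A * (X n + 1) := by
      rw [len_budgetVal]
      push_cast
      calc (2 * (c : ℝ) + 2) * ((rootLen (q + 2) (encodeGraph G)).len : ℝ) ^ (q + 1)
          ≤ (2 * (c : ℝ) + 2) * (2 ^ (q + 1) * (X n + 1)) := by gcongr; exact hroot G
        _ ≤ (2 * c + 2 + 6 * s) * (2 ^ (q + 1) * (X n + 1)) := by
            have := hX0 n
            refine mul_le_mul_of_nonneg_right ?_ (by positivity)
            have : (0 : ℝ) ≤ s := by positivity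
            linarith
        _ = A * (X n + 1) := by rw [hA]; ring
    generalize (budgetVal q c (encodeGraph G)).len = K at *
    have h4 : (2 * (n : ℝ) + 1) ≤ 2 ^ (4 * L n) := by
      calc (2 * (n : ℝ) + 1) ≤ ((n : ℝ) + 2) ^ 2 := by
            have : (0 : ℝ) ≤ n := by positivity
            nlinarith
        _ ≤ ((2 : ℝ) ^ (2 * L n)) ^ 2 := pow_le_pow_left₀ (by positivity) (hn2 n) 2
        _ = _ := by rw [← Real.rpow_natCast, ← Real.rpow_mul (by norm_num)]; ring_nf
    push_cast
    calc (2 * (n : ℝ) + 1) ^ K ≤ ((2 : ℝ) ^ (4 * L n)) ^ K :=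
          pow_le_pow_left₀ (by positivity) h4 K
      _ = 2 ^ (4 * L n * K) := by rw [← Real.rpow_natCast, ← Real.rpow_mul (by norm_num)]
      _ ≤ _ := by
          refine Real.rpow_le_rpow_of_exponent_le (by norm_num) ?_
          calc 4 * L n * K ≤ 4 * L n * (A * (X n + 1)) := by gcongr
            _ = _ := by ring
  have h3 : (U n : ℝ) + 1 ≤ 2 ^ (((b : ℝ) + 2) + B * (X n + 1) * L n ^ (k + 1) + 2 * L n * d) := by
    have h4 : (U n : ℝ) ≤ (2 : ℝ) ^ (B * (X n + 1) * L n ^ (k + 1)) * ((n : ℝ) + 1) ^ d + b := by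
      rw [hU]
      exact Nat.floor_le (by positivity)
    have h5 : ((n : ℝ) + 1) ^ d ≤ 2 ^ (2 * L n * d) := by
      calc ((n : ℝ) + 1) ^ d ≤ ((2 : ℝ) ^ (2 * L n)) ^ d :=
            pow_le_pow_left₀ (by positivity) (by linarith [hn2 n]) d
        _ = _ := by rw [← Real.rpow_natCast, ← Real.rpow_mul (by norm_num)]
    have h6 : (1 : ℝ) ≤ 2 ^ (B * (X n + 1) * L n ^ (k + 1)) :=
      Real.one_le_rpow (by norm_num) (by have := hX0 n; positivity)
    have h7 : (1 : ℝ) ≤ 2 ^ (2 * L n * d) := Real.one_le_rpow (by norm_num) (by positivity)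
    have h8 : (b : ℝ) + 2 ≤ 2 ^ ((b : ℝ) + 2) := by
      have : b + 2 ≤ 2 ^ (b + 2) := (Nat.lt_two_pow_self).le
      calc (b : ℝ) + 2 ≤ (2 : ℝ) ^ (b + 2) := by exact_mod_cast this
        _ = 2 ^ ((b : ℝ) + 2) := by rw [← Real.rpow_natCast]; push_cast; rfl
    rw [Real.rpow_add (by norm_num), Real.rpow_add (by norm_num)]
    generalize (2 : ℝ) ^ (B * (X n + 1) * L n ^ (k + 1)) = y at *
    generalize (2 : ℝ) ^ (2 * L n * d) = z at *
    have hyz : 1 ≤ y * z := by nlinarith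
    have h9 : y * ((n : ℝ) + 1) ^ d ≤ y * z := by gcongr
    calc (U n : ℝ) + 1 ≤ ((b : ℝ) + 2) * (y * z) := by
          have : (0 : ℝ) ≤ b := by positivity
          nlinarith
      _ ≤ 2 ^ ((b : ℝ) + 2) * (y * z) := by gcongr
      _ = _ := by ring
  calc (t : ℝ) ≤ _ := ht'
    _ ≤ ((2 : ℝ) ^ (8 * L n) * 2 ^ (4 * A * ((X n + 1) * L n))) ^ kk *
        2 ^ (((b : ℝ) + 2) + B * (X n + 1) * L n ^ (k + 1) + 2 * L n * d) := by gcongr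
    _ = 2 ^ ((8 * L n + 4 * A * ((X n + 1) * L n)) * kk +
        (((b : ℝ) + 2) + B * (X n + 1) * L n ^ (k + 1) + 2 * L n * d)) := by
        rw [← Real.rpow_add (by norm_num), ← Real.rpow_natCast, ← Real.rpow_mul (by norm_num),
          ← Real.rpow_add (by norm_num)]
    _ ≤ _ := by
        refine Real.rpow_le_rpow_of_exponent_le (by norm_num) ?_
        have e1 : L n ≤ L n ^ (k + 1) := le_self_pow₀ (hL1 n) (by omega)
        have e2 : (X n + 1) * L n ≤ (X n + 1) * L n ^ (k + 1) := by
          have := hX0 n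
          gcongr
        have e3 : L n ≤ (X n + 1) * L n := by nlinarith [hX0 n]
        have e4 : L n ≤ (X n + 1) * L n ^ (k + 1) := e3.trans e2
        have e5 : 1 ≤ (X n + 1) * L n ^ (k + 1) := hYL.trans e2
        rw [hE]
        have g1 : (8 * L n + 4 * A * ((X n + 1) * L n)) * kk ≤
            (8 * ((X n + 1) * L n ^ (k + 1)) + 4 * A * ((X n + 1) * L n ^ (k + 1))) * kk := by
          gcongr
        have g2 : ((b : ℝ) + 2) ≤ (b + 2) * ((X n + 1) * L n ^ (k + 1)) :=
          le_mul_of_one_le_right (by positivity) e5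
        have g3 : 2 * L n * d ≤ 2 * ((X n + 1) * L n ^ (k + 1)) * d := by gcongr
        nlinarith

theorem theorem2 (C D : GraphClass)
    (hsparse : C.LinearlySparse)
    (hhereditary : D.Hereditary)
    (htw : SolvableInTreewidthTime C D) :
    (D.DegreeSeparators → SolvableInSubexpTime C D (2 / 3)) ∧
    (D.SqrtDegreeSeparators → SolvableInSubexpTime C D (3 / 4)) := by
  refine ⟨fun h => ?_, fun h => ?_⟩
  · have := solvableInSubexpTime_of_powerSeparators hsparse hhereditary htw h.powerSeparators
    norm_num at this
    exact this
  · have := solvableInSubexpTime_of_powerSeparators hsparse hhereditary htw h.powerSeparators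
    norm_num at this
    exact this
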